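/- Let $0\le\omega<1$, $-\pi/2<\theta_0<\pi/2$, $\mu_0=\cos\theta_0$, and write $\mu=\cos\theta$. Let $\psi_d(\theta,\tau)$ ($-\pi<\theta<\pi$, $\tau\ge0$) be a real solution of the half-space transport equation with isotropic cylindrical scattering $$\mu\,\frac{\partial\psi_d}{\partial\tau}(\theta,\tau)+\psi_d(\theta,\tau)=\frac{\omega}{2\pi}\int_{-\pi}^{\pi}\psi_d(\theta',\tau)\,d\theta'+\frac{\omega}{2\pi}e^{-\tau/\mu_0}\qquad(\tau>0,\ \mu\ne0),$$ with $\psi_d(\cdot,\tau)$ integrable for each $\tau>0$, $\psi_d(\theta,\cdot)$ continuous at $\tau=0$ whenever $\mu\neq0$, and no re-entrant diffuse flux: $\psi_d(\theta,0)=0$ for $|\theta|<\pi/2$. Assume that its Laplace transforms exist in the right half-plane: for every $\sigma>0$, $e^{-\sigma\tau}\psi_d(\theta,\tau)$ is integrable in $\tau\in(0,\infty)$ for each $\theta$ with $\mu\ne0$, and integrable in $(\theta,\tau)\in(-\pi,\pi)\times(0,\infty)$. Put $\rho_d(\tau)=\int_{-\pi}^{\pi}\psi_d(\theta,\tau)\,d\theta$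 and $\hat\rho_d(s)=\int_0^\infty e^{-s\tau}\rho_d(\tau)\,d\tau$. Let $\sqrt{s^2-1}$ be the branch with cuts along the real axis from $1$ to $+\infty$ and from $-1$ to $-\infty$ for which $i\sqrt{s^2-1}<0$ on $(-1,1)$. Let $s_+=\sqrt{1-\omega^2}$, fix $0<\beta<s_+$, and set $$\kappa(s)=\frac{(s^2-1)\{\sqrt{s^2-1}-i\omega\}}{(s^2-s_+^2)\sqrt{s^2-1}},\qquad \kappa_\pm(s)=\exp\left(\frac1{2\pi i}\int_{\pm\beta-i\infty}^{\pm\beta+i\infty}\frac{\operatorname{Log}\kappa(\zeta)}{\zeta-s}\,d\zeta\right),$$ with $\operatorname{Log}$ the principal logarithm. Then: 1. For $|\Re s|<1$, $\displaystyle I=\int_{-\pi}^{\pi}\frac{d\theta}{1+s\mu}=\frac{2\pi i}{\sqrt{s^2-1}}$. 2. The contour integral for $\kappa_+(s)$ converges absolutely for $\Re s<\beta$, that for $\kappa_-(s)$ for $\Re s>-\beta$. The functions $\kappa_+$ and $\kappa_-$ are analytic in these respective half-planes, and $\kappa(s)=\kappa_+(s)/\kappa_-(s)$ for $|\Re s|<\beta$.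 3. For $\Re s>0$, $$\hat\rho_d(s)=\frac{\mu_0(1+\mu_0)}{\kappa_+(-1/\mu_0)(1+\mu_0s_+)}\,\frac{(s+1)\kappa_-(s)}{(s+s_+)(1+\mu_0s)}-\frac{\mu_0}{1+\mu_0s}.$$ 4. For $\pi/2<|\theta|<\pi$, so that $-1<\mu<0$, the emergent diffuse flux is $$\psi_d(\theta,0)=-\frac{\omega}{2\pi\mu}\hat\rho_d(-1/\mu)+\frac{\omega}{2\pi}\frac{\mu_0}{\mu_0-\mu}=\frac{\omega}{2\pi}\frac{\mu_0(1+\mu_0)(1-\mu)\,\kappa_-(-1/\mu)}{(\mu_0-\mu)(1+\mu_0s_+)(1-\mu s_+)\,\kappa_+(-1/\mu_0)}$$ $$=\frac{\omega}{2\pi}\frac{\mu_0(1+\mu_0)(1-\mu)}{(\mu_0-\mu)(1+\mu_0s_+)(1-\mu s_+)}\,\kappa_-(1/\mu_0)\kappa_-(-1/\mu)=\frac{\omega}{2\pi}\frac{\mu_0(1+\mu_0)(1-\mu)}{(\mu_0-\mu)(1+\mu_0s_+)(1-\mu s_+)}\,\frac{1}{\kappa_+(-1/\mu_0)\,\kappa_+(1/\mu)}.$$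 -/

import Mathlib

open MeasureTheory Set Filter Topology

noncomputable section

namespace Albedo

/-- The diffuse photon density `ρ_d(τ) = ∫_{-π}^{π} ψ_d(θ, τ) dθ` (up to the speed of light). -/
def photonDensity (ψ : ℝ → ℝ → ℝ) (τ : ℝ) : ℝ :=
  ∫ θ in (-Real.pi)..Real.pi, ψ θ τ

/-- The one-sided Laplace transform `∫_0^∞ e^{-sτ} f(τ) dτ`. -/
def laplace (f : ℝ → ℝ) (s : ℂ) : ℂ :=
  ∫ τ in Ioi (0 : ℝ), Complex.exp (-s * (τ : ℂ)) * (f τ : ℂ)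

/-- `ψ θ τ` is a diffuse flux in the half space `τ ≥ 0` with isotropic cylindrical scattering,
single-scattering albedo `ω` and incidence angle `θ₀`. With `μ = cos θ` and `μ₀ = cos θ₀`, it solves
`μ ∂ψ/∂τ + ψ = (ω/2π) ∫ ψ(θ', τ) dθ' + (ω/2π) e^{-τ/μ₀}` for `τ > 0`, is continuous up to `τ = 0`,
vanishes at `τ = 0` in the inward directions, and possesses (absolutely convergent) Laplace
transforms in the right half-plane, both at fixed angle and jointly in angle and depth.
The grazing angles `μ = 0` (a null set of directions) are left unconstrained. -/
structure IsDiffuseFlux (ω θ₀ : ℝ) (ψ : ℝ → ℝ → ℝ) : Prop where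
  integrable_angle : ∀ τ : ℝ, 0 < τ →
    IntegrableOn (fun θ => ψ θ τ) (Ioo (-Real.pi) Real.pi)
  differentiable : ∀ θ ∈ Ioo (-Real.pi) Real.pi, Real.cos θ ≠ 0 → ∀ τ : ℝ, 0 < τ →
    DifferentiableAt ℝ (ψ θ) τ
  transport : ∀ θ ∈ Ioo (-Real.pi) Real.pi, Real.cos θ ≠ 0 → ∀ τ : ℝ, 0 < τ →
    Real.cos θ * deriv (ψ θ) τ + ψ θ τ =
      ω / (2 * Real.pi) * (∫ θ' in (-Real.pi)..Real.pi, ψ θ' τ)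
        + ω / (2 * Real.pi) * Real.exp (-τ / Real.cos θ₀)
  continuous_boundary : ∀ θ ∈ Ioo (-Real.pi) Real.pi, Real.cos θ ≠ 0 →
    ContinuousWithinAt (ψ θ) (Ici 0) 0
  no_reentrant : ∀ θ : ℝ, |θ| < Real.pi / 2 → ψ θ 0 = 0
  laplace_angle : ∀ θ ∈ Ioo (-Real.pi) Real.pi, Real.cos θ ≠ 0 → ∀ σ : ℝ, 0 < σ →
    IntegrableOn (fun τ => Real.exp (-σ * τ) * ψ θ τ) (Ioi 0)
  laplace_joint : ∀ σ : ℝ, 0 < σ →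
    IntegrableOn (fun p : ℝ × ℝ => Real.exp (-σ * p.2) * ψ p.1 p.2)
      (Ioo (-Real.pi) Real.pi ×ˢ Ioi (0 : ℝ))

/-- The branch of `√(s² - 1) = √(s - 1) √(s + 1)` with cuts from `1` to `+∞` and from `-1` to `-∞`
along the real axis, for which `i √(s² - 1)` is real and negative on `(-1, 1)`. The powers on the
right are principal ones. -/
def branchSqrt (s : ℂ) : ℂ :=
  Complex.I * ((1 - s) ^ (1 / 2 : ℂ) * (1 + s) ^ (1 / 2 : ℂ))

/-- `s₊ = √(1 - ω²)`. -/
def sPlus (ω : ℝ) : ℝ := Real.sqrt (1 - ω ^ 2)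

/-- `κ(s) = (s² - 1)(√(s² - 1) - iω) / ((s² - s₊²) √(s² - 1))`. -/
def kappa (ω : ℝ) (s : ℂ) : ℂ :=
  ((s ^ 2 - 1) * (branchSqrt s - Complex.I * (ω : ℂ))) /
    ((s ^ 2 - (sPlus ω : ℂ) ^ 2) * branchSqrt s)

/-- The function of `t` whose integral over `ℝ` is the contour integral
`∫_{c - i∞}^{c + i∞} Log κ(ζ) / (ζ - s) dζ`, through `ζ = c + i t`, `dζ = i dt`. -/
def contourIntegrand (ω c : ℝ) (s : ℂ) (t : ℝ) : ℂ :=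
  Complex.log (kappa ω ((c : ℂ) + Complex.I * (t : ℂ))) /
    (((c : ℂ) + Complex.I * (t : ℂ)) - s) * Complex.I

/-- `exp ((1 / 2πi) ∫_{c - i∞}^{c + i∞} Log κ(ζ) / (ζ - s) dζ)`. -/
def cauchyExp (ω c : ℝ) (s : ℂ) : ℂ :=
  Complex.exp (1 / (2 * (Real.pi : ℂ) * Complex.I) * ∫ t : ℝ, contourIntegrand ω c s t)

/-- The Wiener-Hopf factor `κ₊`, with its contour along `Re ζ = β`. -/
def kappaPlus (ω β : ℝ) (s : ℂ) : ℂ := cauchyExp ω β s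

/-- The Wiener-Hopf factor `κ₋`, with its contour along `Re ζ = -β`. -/
def kappaMinus (ω β : ℝ) (s : ℂ) : ℂ := cauchyExp ω (-β) s

end Albedo

end

/-!
The Laplace transform in `τ` turns the transport equation into
`(1 + s μ) ψ̂(θ, s) = μ ψ_d(θ, 0) + (ω / 2π) Ŝ(s)`, where `Ŝ(s) = ρ̂_d(s) + μ₀ / (1 + μ₀ s)`.
Dividing by `1 + s μ` and integrating over all angles gives, for `0 < Re s < 1`, the Wiener–Hopf
equation `Ŝ(s) (1 - ω / w) = μ₀ / (1 + μ₀ s) + B(s)` with `w = √(1 - s²)`. Here `Ŝ` is analytic for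
`Re s > 0`, while the boundary term `B`, to which only the outgoing directions `μ ≤ 0` contribute,
is analytic for `Re s < 1`.

Since `1 - (ω / w)² = (s² - s₊²) / (s² - 1)`, the function `κ` is `(1 + ω / w)⁻¹`. It has positive
real part for `|Re s| < s₊`, and its logarithm is square-integrable along vertical lines, so that
Cauchy's formula for the strip splits `Log κ` and yields `κ = κ₊ / κ₋`. After factorization, the two
sides of the Wiener–Hopf equation continue each other to an entire function of at most linear
growth that is `o(s)` along the positive reals. It is therefore constant, and its value is read off
at the pole `s = -1 / μ₀`. Finally, for `μ < 0` the factor `1 + s μ` vanishes at `s = -1 / μ`, where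
the transformed transport equation determines `ψ_d(θ, 0)`.
-/

namespace Albedo

open Complex

section HolomorphicIntegral

variable {α E : Type*} [MeasurableSpace α] {ν : Measure α} [NormedAddCommGroup E]
  [NormedSpace ℂ E]

-- Cauchy's estimate turns the bound on `F` into a bound on `∂F/∂z`, so no derivative of the
-- integrand has to be computed or dominated.
lemma differentiableAt_integral_of_dominated [CompleteSpace E] {F : ℂ → α → E} {bound : α → ℝ}
    {U : Set ℂ} {s : ℂ} (hU : U ∈ 𝓝 s) (hF_meas : ∀ z ∈ U, AEStronglyMeasurable (F z) ν)
    (hF_le : ∀ᵐ a ∂ν, ∀ z ∈ U, ‖F z a‖ ≤ bound a) (hbound : Integrable bound ν)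
    (hF_diff : ∀ᵐ a ∂ν, DifferentiableOn ℂ (fun z => F z a) U) :
    DifferentiableAt ℂ (fun z => ∫ a, F z a ∂ν) s := by
  obtain ⟨r, hr, hrU⟩ := Metric.nhds_basis_closedBall.mem_iff.1 hU
  have hr2 : 0 < r / 2 := half_pos hr
  have hU_of_mem_ball : ∀ z ∈ Metric.ball s (r / 2), U ∈ 𝓝 z := fun z hz =>
    Filter.mem_of_superset (Metric.isOpen_ball.mem_nhds
      (Metric.ball_subset_ball (half_le_self hr.le) hz)) (Metric.ball_subset_closedBall.trans hrU)
  have hclosedBall : ∀ z ∈ Metric.ball s (r / 2), Metric.closedBall z (r / 2) ⊆ U := by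
    intro z hz
    refine (Metric.closedBall_subset_closedBall' ?_).trans hrU
    linarith [Metric.mem_ball.1 hz]
  have hderiv : ∀ᵐ a ∂ν, ∀ z ∈ Metric.ball s (r / 2),
      HasDerivAt (fun z => F z a) (deriv (fun z => F z a) z) z := by
    filter_upwards [hF_diff] with a ha z hz
    exact (ha.differentiableAt (hU_of_mem_ball z hz)).hasDerivAt
  have hderiv_le : ∀ᵐ a ∂ν, ∀ z ∈ Metric.ball s (r / 2),
      ‖deriv (fun z => F z a) z‖ ≤ bound a / (r / 2) := by
    filter_upwards [hF_diff, hF_le] with a ha hle z hz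
    exact norm_deriv_le_of_forall_mem_sphere_norm_le hr2
      (ha.diffContOnCl_ball (hclosedBall z hz))
      fun w hw => hle w (hclosedBall z hz (Metric.sphere_subset_closedBall hw))
  have hderiv_meas : AEStronglyMeasurable (fun a => deriv (fun z => F z a) s) ν := by
    obtain ⟨u, hu⟩ := Filter.exists_seq_tendsto (𝓝[≠] s)
    obtain ⟨N, hN⟩ := eventually_atTop.1 (hu.eventually (mem_nhdsWithin_of_mem_nhds hU))
    refine aestronglyMeasurable_of_tendsto_ae atTop
      (f := fun n a => slope (fun z => F z a) s (u (n + N))) (fun n => ?_) ?_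
    · exact ((hF_meas _ (hN _ (Nat.le_add_left N n))).sub
        (hF_meas s (mem_of_mem_nhds hU))).const_smul (u (n + N) - s)⁻¹
    · filter_upwards [hderiv] with a ha
      exact (hasDerivAt_iff_tendsto_slope.1 (ha s (Metric.mem_ball_self hr2))).comp
        (hu.comp (tendsto_add_atTop_nat N))
  have hs_le : ∀ᵐ a ∂ν, ‖F s a‖ ≤ bound a := by
    filter_upwards [hF_le] with a ha using ha s (mem_of_mem_nhds hU)
  exact (hasDerivAt_integral_of_dominated_loc_of_deriv_le (Metric.ball_mem_nhds s hr2)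
    (Filter.mem_of_superset hU hF_meas) (hbound.mono' (hF_meas s (mem_of_mem_nhds hU)) hs_le)
    hderiv_meas hderiv_le (hbound.div_const _) hderiv).2.differentiableAt

end HolomorphicIntegral

section EntireFunctions

variable {E : Type*} [NormedAddCommGroup E] [NormedSpace ℂ E]

lemma deriv_eq_of_norm_le_linear [CompleteSpace E] {h : ℂ → E} (hd : Differentiable ℂ h) {C : ℝ}
    (hC : ∀ z, ‖h z‖ ≤ C * (1 + ‖z‖)) (z w : ℂ) : deriv h z = deriv h w := by
  have hC0 : 0 ≤ C := by simpa using (norm_nonneg _).trans (hC 0)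
  refine hd.deriv.apply_eq_apply_of_bounded ((isBounded_iff_forall_norm_le).2 ⟨2 * C, ?_⟩) z w
  rintro _ ⟨c, rfl⟩
  have hR : 0 < 1 + ‖c‖ := by positivity
  have hsphere : ∀ z ∈ Metric.sphere c (1 + ‖c‖), ‖h z‖ ≤ 2 * C * (1 + ‖c‖) := by
    intro z hz
    have hz_le : ‖z‖ ≤ ‖c‖ + (1 + ‖c‖) := by
      simpa [mem_sphere_iff_norm.1 hz] using norm_add_le c (z - c)
    nlinarith [hC z]
  exact (norm_deriv_le_of_forall_mem_sphere_norm_le hR hd.diffContOnCl hsphere).trans_eq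
    (by field_simp)

lemma eq_of_norm_le_linear_of_tendsto_smul [CompleteSpace E] {h : ℂ → E}
    (hd : Differentiable ℂ h) {C : ℝ} (hC : ∀ z, ‖h z‖ ≤ C * (1 + ‖z‖))
    (hlim : Tendsto (fun x : ℝ => (x : ℂ)⁻¹ • h x) atTop (𝓝 0)) (z w : ℂ) : h z = h w := by
  have hderiv : ∀ z, HasDerivAt (fun z => h z - z • deriv h 0) 0 z := fun z => by
    have := (hd z).hasDerivAt.sub ((hasDerivAt_id z).smul_const (deriv h 0))
    rwa [deriv_eq_of_norm_le_linear hd hC z 0, one_smul, sub_self] at this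
  have haffine : ∀ z w, h z - z • deriv h 0 = h w - w • deriv h 0 :=
    is_const_of_deriv_eq_zero (fun z => (hderiv z).differentiableAt) fun z => (hderiv z).deriv
  have hslope : Tendsto (fun x : ℝ => (x : ℂ)⁻¹ • h x) atTop (𝓝 (deriv h 0)) := by
    have hinv : Tendsto (fun x : ℝ => (x : ℂ)⁻¹) atTop (𝓝 0) := by
      simpa [Function.comp_def] using
        (continuous_ofReal.tendsto 0).comp (tendsto_inv_atTop_zero (𝕜 := ℝ))
    have hmain := (hinv.smul_const (h 0)).add_const (deriv h 0)
    rw [zero_smul, zero_add] at hmain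
    refine hmain.congr' ?_
    filter_upwards [eventually_ne_atTop 0] with x hx
    have hhx : h x = h 0 + (x : ℂ) • deriv h 0 := by
      simpa [sub_eq_iff_eq_add] using haffine x 0
    rw [hhx, smul_add, inv_smul_smul₀ (ofReal_ne_zero.2 hx)]
  simpa [tendsto_nhds_unique hslope hlim] using haffine z w

lemma exists_differentiable_extension {f g : ℂ → E} {U V : Set ℂ} (hU : IsOpen U) (hV : IsOpen V)
    (hUV : U ∪ V = univ) (hf : DifferentiableOn ℂ f U) (hg : DifferentiableOn ℂ g V)
    (hfg : EqOn f g (U ∩ V)) :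
    ∃ h : ℂ → E, Differentiable ℂ h ∧ EqOn h f U ∧ EqOn h g V := by
  classical
  have hgV : EqOn (U.piecewise f g) g V := by
    intro z hz
    by_cases hzU : z ∈ U
    · rw [piecewise_eq_of_mem _ _ _ hzU, hfg ⟨hzU, hz⟩]
    · rw [piecewise_eq_of_notMem _ _ _ hzU]
  have hfU : EqOn (U.piecewise f g) f U := U.piecewise_eqOn f g
  refine ⟨U.piecewise f g, fun z => ?_, hfU, hgV⟩
  rcases hUV.symm ▸ mem_univ z with hz | hz
  · exact (hf.congr hfU).differentiableAt (hU.mem_nhds hz)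
  · exact (hg.congr hgV).differentiableAt (hV.mem_nhds hz)

lemma eq_of_eqOn_strip_of_norm_le_linear [CompleteSpace E] {f g : ℂ → E} {a m b C₁ C₂ : ℝ}
    (ham : a < m) (hmb : m < b)
    (hf : DifferentiableOn ℂ f {s | a < s.re}) (hg : DifferentiableOn ℂ g {s | s.re < b})
    (hfg : ∀ s : ℂ, a < s.re → s.re < b → f s = g s)
    (hfC : ∀ s : ℂ, m ≤ s.re → ‖f s‖ ≤ C₁ * (1 + ‖s‖))
    (hgC : ∀ s : ℂ, s.re ≤ m → ‖g s‖ ≤ C₂ * (1 + ‖s‖))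
    (hlim : Tendsto (fun x : ℝ => (x : ℂ)⁻¹ • f x) atTop (𝓝 0)) {s t : ℂ} (hs : a < s.re)
    (ht : t.re < b) : f s = g t := by
  have hcover : {s : ℂ | a < s.re} ∪ {s | s.re < b} = univ :=
    eq_univ_of_forall fun s => (lt_or_ge a s.re).imp_right fun h => h.trans_lt (ham.trans hmb)
  obtain ⟨h, hd, hhf, hhg⟩ := exists_differentiable_extension
    (isOpen_lt continuous_const continuous_re) (isOpen_lt continuous_re continuous_const)
    hcover hf hg fun s hs => hfg s hs.1 hs.2
  have hgrowth : ∀ z, ‖h z‖ ≤ max C₁ C₂ * (1 + ‖z‖) := by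
    intro z
    rcases le_total m z.re with hz | hz
    · rw [hhf (ham.trans_le hz)]
      exact (hfC z hz).trans (by gcongr; exact le_max_left _ _)
    · rw [hhg (hz.trans_lt hmb)]
      exact (hgC z hz).trans (by gcongr; exact le_max_right _ _)
  have hh_lim : Tendsto (fun x : ℝ => (x : ℂ)⁻¹ • h x) atTop (𝓝 0) := by
    refine hlim.congr' ?_
    filter_upwards [eventually_gt_atTop a] with x hx
    rw [hhf (by simpa using hx)]
  rw [← hhf hs, ← hhg ht, eq_of_norm_le_linear_of_tendsto_smul hd hgrowth hh_lim s t]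

end EntireFunctions

section VerticalCauchyIntegral

/-- The Cauchy integral `∫ f(ζ) / (ζ - s) dζ` along the line `Re ζ = c`, oriented upwards. -/
noncomputable def verticalCauchyIntegral (f : ℂ → ℂ) (c : ℝ) (s : ℂ) : ℂ :=
  ∫ t : ℝ, f (c + I * t) / (c + I * t - s) * I

variable {f : ℂ → ℂ} {c d : ℝ} {s : ℂ}

lemma integrable_inv_sq_add_sq {a : ℝ} (ha : 0 < a) (x₀ : ℝ) :
    Integrable fun t : ℝ => (a ^ 2 + (t - x₀) ^ 2)⁻¹ := by
  have h := ((integrable_inv_one_add_sq.comp_div ha.ne').comp_sub_right x₀).const_mul (a ^ 2)⁻¹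
  refine h.congr (ae_of_all _ fun t => ?_)
  simp only [← mul_inv]
  congr 1
  field_simp

lemma integral_inv_sq_add_sq {a : ℝ} (ha : 0 < a) (x₀ : ℝ) :
    ∫ t : ℝ, (a ^ 2 + (t - x₀) ^ 2)⁻¹ = Real.pi / a := by
  rw [integral_sub_right_eq_self (fun t : ℝ => (a ^ 2 + t ^ 2)⁻¹) x₀]
  have hscale : (fun t : ℝ => (a ^ 2 + t ^ 2)⁻¹) = fun t => (a ^ 2)⁻¹ * (1 + (t / a) ^ 2)⁻¹ := by
    ext t
    rw [← mul_inv]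
    congr 1
    field_simp
  rw [hscale, integral_const_mul, Measure.integral_comp_div (fun t : ℝ => (1 + t ^ 2)⁻¹) a,
    integral_univ_inv_one_add_sq, abs_of_pos ha, smul_eq_mul]
  field_simp

lemma sq_norm_vertical_sub (c : ℝ) (s : ℂ) (t : ℝ) :
    ‖(c : ℂ) + I * t - s‖ ^ 2 = (c - s.re) ^ 2 + (t - s.im) ^ 2 := by
  rw [← normSq_eq_norm_sq, normSq_apply]
  simp [sq]

lemma abs_sub_re_le_norm_vertical_sub (c : ℝ) (s : ℂ) (t : ℝ) :
    |c - s.re| ≤ ‖(c : ℂ) + I * t - s‖ := by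
  simpa using abs_re_le_norm ((c : ℂ) + I * t - s)

lemma vertical_sub_ne_zero (hs : s.re ≠ c) (t : ℝ) : (c : ℂ) + I * t - s ≠ 0 :=
  norm_pos_iff.1 <| (abs_pos.2 (sub_ne_zero.2 hs.symm)).trans_le
    (abs_sub_re_le_norm_vertical_sub c s t)

lemma norm_cauchyIntegrand_le (hd : 0 < d) (hs : d ≤ |c - s.re|) (t : ℝ) :
    ‖f (c + I * t) / (c + I * t - s) * I‖ ≤
      (‖f (c + I * t)‖ ^ 2 + (d ^ 2 + (t - s.im) ^ 2)⁻¹) / 2 := by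
  have hden : (‖(c : ℂ) + I * t - s‖⁻¹) ^ 2 ≤ (d ^ 2 + (t - s.im) ^ 2)⁻¹ := by
    rw [inv_pow, sq_norm_vertical_sub, ← sq_abs (c - s.re)]
    gcongr
  rw [norm_mul, norm_div, norm_I, mul_one, div_eq_mul_inv]
  nlinarith [sq_nonneg (‖f (c + I * t)‖ - ‖(c : ℂ) + I * t - s‖⁻¹)]

lemma aestronglyMeasurable_cauchyIntegrand
    (hf : AEStronglyMeasurable (fun t : ℝ => f (c + I * t))) (s : ℂ) :
    AEStronglyMeasurable fun t : ℝ => f (c + I * t) / (c + I * t - s) * I :=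
  ((hf.aemeasurable.div (by fun_prop)).mul_const I).aestronglyMeasurable

lemma integrable_cauchyIntegrand (hf : MemLp (fun t : ℝ => f (c + I * t)) 2) (hs : s.re ≠ c) :
    Integrable fun t : ℝ => f (c + I * t) / (c + I * t - s) * I := by
  have hd : 0 < |c - s.re| := abs_pos.2 (sub_ne_zero.2 hs.symm)
  have hbound := ((memLp_two_iff_integrable_sq_norm hf.1).1 hf).add
    (integrable_inv_sq_add_sq hd s.im)
  exact (hbound.div_const 2).mono' (aestronglyMeasurable_cauchyIntegrand hf.1 s)
    (ae_of_all _ (norm_cauchyIntegrand_le hd le_rfl))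

lemma norm_verticalCauchyIntegral_le (hf : MemLp (fun t : ℝ => f (c + I * t)) 2) (hd : 0 < d)
    (hs : d ≤ |c - s.re|) :
    ‖verticalCauchyIntegral f c s‖ ≤ ((∫ t : ℝ, ‖f (c + I * t)‖ ^ 2) + Real.pi / d) / 2 := by
  have hint₁ := (memLp_two_iff_integrable_sq_norm hf.1).1 hf
  have hint₂ := integrable_inv_sq_add_sq hd s.im
  rw [verticalCauchyIntegral, ← integral_inv_sq_add_sq hd s.im, ← integral_add hint₁ hint₂,
    ← integral_div]
  exact norm_integral_le_of_norm_le ((hint₁.add hint₂).div_const 2)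
    (ae_of_all _ (norm_cauchyIntegrand_le hd hs))

lemma differentiableAt_verticalCauchyIntegral (hf : MemLp (fun t : ℝ => f (c + I * t)) 2)
    (hs : s.re ≠ c) : DifferentiableAt ℂ (verticalCauchyIntegral f c) s := by
  have hd : 0 < |c - s.re| := abs_pos.2 (sub_ne_zero.2 hs.symm)
  have hfar : ∀ z ∈ Metric.ball s (|c - s.re| / 2), ∀ t : ℝ,
      ‖(c : ℂ) + I * t - s‖ / 2 ≤ ‖(c : ℂ) + I * t - z‖ := by
    intro z hz t
    have htri := norm_sub_le_norm_sub_add_norm_sub ((c : ℂ) + I * t) z s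
    linarith [mem_ball_iff_norm.1 hz, abs_sub_re_le_norm_vertical_sub c s t]
  have hfar_pos : ∀ t : ℝ, 0 < ‖(c : ℂ) + I * t - s‖ / 2 := fun t =>
    half_pos (norm_pos_iff.2 (vertical_sub_ne_zero hs t))
  refine differentiableAt_integral_of_dominated (Metric.ball_mem_nhds s (half_pos hd))
    (fun z _ => aestronglyMeasurable_cauchyIntegrand hf.1 z)
    (ae_of_all _ fun t z hz => ?_) ((integrable_cauchyIntegrand hf hs).norm.const_mul 2)
    (ae_of_all _ fun t z hz => ?_)
  · calc ‖f (c + I * t) / (c + I * t - z) * I‖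
        ≤ ‖f (c + I * t)‖ / (‖(c : ℂ) + I * t - s‖ / 2) := by
          rw [norm_mul, norm_I, mul_one, norm_div]
          gcongr
          exacts [hfar_pos t, hfar z hz t]
      _ = 2 * ‖f (c + I * t) / (c + I * t - s) * I‖ := by
          rw [norm_mul, norm_I, mul_one, norm_div]
          field_simp
  · have hne : (c : ℂ) + I * t - z ≠ 0 := norm_pos_iff.1 ((hfar_pos t).trans_le (hfar z hz t))
    exact (((differentiableAt_const _).div (by fun_prop) hne).mul_const I).differentiableWithinAt

lemma verticalCauchyIntegral_neg (hf : ∀ z, f (-z) = f z) (c : ℝ) (s : ℂ) :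
    verticalCauchyIntegral f (-c) (-s) = -verticalCauchyIntegral f c s := by
  rw [verticalCauchyIntegral, verticalCauchyIntegral, ← integral_neg,
    ← integral_neg_eq_self (fun t : ℝ => f (((-c : ℝ) : ℂ) + I * t) / (((-c : ℝ) : ℂ) + I * t - -s)
      * I)]
  congr 1 with t
  have hpoint : ((-c : ℝ) : ℂ) + I * ((-t : ℝ) : ℂ) = -((c : ℂ) + I * t) := by push_cast; ring
  rw [hpoint, hf, neg_sub_neg, ← neg_sub, div_neg, neg_mul]

end VerticalCauchyIntegral

section CauchyFormulaStrip

lemma tendsto_log_add_ofReal_mul_sub_log (a : ℂ) {u : ℂ} (hu : u ∈ slitPlane) :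
    Tendsto (fun T : ℝ => log (a + T * u) - Real.log T) atTop (𝓝 (log u)) := by
  have hdiv : Tendsto (fun T : ℝ => a / T + u) atTop (𝓝 u) := by
    have h : Tendsto (fun T : ℝ => ((T⁻¹ : ℝ) : ℂ)) atTop (𝓝 ((0 : ℝ) : ℂ)) :=
      (continuous_ofReal.tendsto 0).comp tendsto_inv_atTop_zero
    simpa [div_eq_mul_inv] using (h.const_mul a).add_const u
  refine ((continuousAt_clog hu).tendsto.comp hdiv).congr' ?_
  filter_upwards [eventually_gt_atTop 0, hdiv.eventually_mem (isOpen_slitPlane.mem_nhds hu)]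
    with T hT hslit
  have hfactor : a + T * u = T * (a / T + u) := by
    have : (T : ℂ) ≠ 0 := ofReal_ne_zero.2 hT.ne'
    field_simp
  rw [hfactor, log_ofReal_mul hT (slitPlane_ne_zero hslit), add_sub_cancel_left,
    Function.comp_apply]

lemma tendsto_integral_inv_vertical_of_re_lt {c : ℝ} {s : ℂ} (hs : s.re < c) :
    Tendsto (fun T : ℝ => ∫ t in (-T)..T, I / (c + I * t - s)) atTop (𝓝 (Real.pi * I)) := by
  have hre : ∀ t : ℝ, 0 < (c + I * t - s).re := fun t => by simpa using hs
  have hderiv : ∀ t : ℝ, HasDerivAt (fun t : ℝ => log (c + I * t - s)) (I / (c + I * t - s)) t := by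
    intro t
    simpa using (((((hasDerivAt_id (t : ℂ)).const_mul I).const_add (c : ℂ)).sub_const s).clog
      (Or.inl (hre t))).comp_ofReal
  have hcont : Continuous fun t : ℝ => I / (c + I * t - s) :=
    continuous_const.div (by fun_prop) (vertical_sub_ne_zero hs.ne)
  have hlog := (tendsto_log_add_ofReal_mul_sub_log ((c : ℂ) - s) (u := I) (Or.inr (by simp))).sub
    (tendsto_log_add_ofReal_mul_sub_log ((c : ℂ) - s) (u := -I) (Or.inr (by simp)))
  rw [log_I, log_neg_I, show (Real.pi : ℂ) / 2 * I - -(Real.pi / 2) * I = Real.pi * I by ring]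
    at hlog
  refine hlog.congr fun T => ?_
  rw [intervalIntegral.integral_eq_sub_of_hasDerivAt (fun t _ => hderiv t)
    (hcont.intervalIntegrable _ _)]
  push_cast
  ring_nf

lemma tendsto_integral_inv_vertical_of_lt_re {c : ℝ} {s : ℂ} (hs : c < s.re) :
    Tendsto (fun T : ℝ => ∫ t in (-T)..T, I / (c + I * t - s)) atTop (𝓝 (-(Real.pi * I))) := by
  refine (tendsto_integral_inv_vertical_of_re_lt (c := -c) (s := -s) (by simpa)).neg.congr
    fun T => ?_
  have hreflect := intervalIntegral.integral_comp_neg (a := -T) (b := T)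
    (fun t : ℝ => I / ((c : ℂ) + I * t - s))
  rw [neg_neg] at hreflect
  rw [← hreflect, ← intervalIntegral.integral_neg]
  refine intervalIntegral.integral_congr fun t _ => ?_
  rw [← div_neg]
  congr 1
  push_cast
  ring

lemma tendsto_integral_dslope_horizontal {f : ℂ → ℂ} {a b M : ℝ} {s : ℂ} (hs : s.re ∈ Icc a b)
    (hM : ∀ z : ℂ, z.re ∈ Icc a b → ‖f z‖ ≤ M) :
    Tendsto (fun y : ℝ => ∫ x in a..b, dslope f s (x + y * I)) (cocompact ℝ) (𝓝 0) := by
  have hlim : Tendsto (fun y : ℝ => 2 * M / (|y| - |s.im|) * |b - a|) (cocompact ℝ) (𝓝 0) := by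
    have : Tendsto (fun y : ℝ => |y| - |s.im|) (cocompact ℝ) atTop :=
      tendsto_atTop_add_const_right _ _ (tendsto_norm_cocompact_atTop (E := ℝ))
    simpa using (this.const_div_atTop (2 * M)).mul_const |b - a|
  refine squeeze_zero_norm' ?_ hlim
  filter_upwards [(tendsto_norm_cocompact_atTop (E := ℝ)).eventually_gt_atTop |s.im|] with y hy
  refine intervalIntegral.norm_integral_le_of_norm_le_const fun x hx => ?_
  rw [uIoc_of_le (hs.1.trans hs.2)] at hx
  have hdist : |y| - |s.im| ≤ ‖(x : ℂ) + y * I - s‖ :=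
    (abs_sub_abs_le_abs_sub y s.im).trans (by simpa using abs_im_le_norm ((x : ℂ) + y * I - s))
  have hgap : 0 < |y| - |s.im| := sub_pos.2 hy
  have hnum : ‖f (x + y * I) - f s‖ ≤ 2 * M := by
    have hMx := hM (x + y * I) (by simpa using Ioc_subset_Icc_self hx)
    linarith [norm_sub_le (f (x + y * I)) (f s), hM s hs]
  rw [dslope_of_ne _ (sub_ne_zero.1 (norm_pos_iff.1 (hgap.trans_le hdist))), slope_def_field,
    norm_div]
  gcongr
  exact (norm_nonneg _).trans hnum

lemma tendsto_integral_dslope_vertical {f : ℂ → ℂ} {c : ℝ} {s L : ℂ} (hs : s.re ≠ c)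
    (hf : Integrable fun t : ℝ => f (c + I * t) / (c + I * t - s) * I)
    (hL : Tendsto (fun T : ℝ => ∫ t in (-T)..T, I / (c + I * t - s)) atTop (𝓝 L)) :
    Tendsto (fun T : ℝ => I • ∫ y in (-T)..T, dslope f s (c + y * I)) atTop
      (𝓝 (verticalCauchyIntegral f c s - f s * L)) := by
  have hcont : Continuous fun t : ℝ => I / (c + I * t - s) :=
    continuous_const.div (by fun_prop) (vertical_sub_ne_zero hs)
  refine ((intervalIntegral_tendsto_integral hf tendsto_neg_atTop_atBot tendsto_id).sub
    (hL.const_mul (f s))).congr fun T => ?_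
  rw [id_eq, ← intervalIntegral.integral_smul, ← intervalIntegral.integral_const_mul,
    ← intervalIntegral.integral_sub hf.intervalIntegrable
      ((hcont.const_mul (f s)).intervalIntegrable _ _)]
  refine intervalIntegral.integral_congr fun t _ => ?_
  have hne := vertical_sub_ne_zero hs t
  simp only [smul_eq_mul]
  rw [mul_comm (t : ℂ) I, dslope_of_ne _ (sub_ne_zero.1 hne), slope_def_field]
  field_simp

lemma verticalCauchyIntegral_sub_eq {f : ℂ → ℂ} {a b M : ℝ} {s : ℂ}
    (hf : DiffContOnCl ℂ f (re ⁻¹' Ioo a b)) (hM : ∀ z : ℂ, z.re ∈ Icc a b → ‖f z‖ ≤ M)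
    (hs : s.re ∈ Ioo a b)
    (hfa : Integrable fun t : ℝ => f (a + I * t) / (a + I * t - s) * I)
    (hfb : Integrable fun t : ℝ => f (b + I * t) / (b + I * t - s) * I) :
    verticalCauchyIntegral f b s - verticalCauchyIntegral f a s = 2 * Real.pi * I * f s := by
  have hab : a < b := hs.1.trans hs.2
  have hopen : IsOpen (re ⁻¹' Ioo a b) := isOpen_Ioo.preimage continuous_re
  have hclosure : closure (re ⁻¹' Ioo a b) = re ⁻¹' Icc a b := by
    rw [closure_preimage_re, closure_Ioo hab.ne]
  have hdslope : DiffContOnCl ℂ (dslope f s) (re ⁻¹' Ioo a b) :=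
    ⟨(differentiableOn_dslope (hopen.mem_nhds hs)).2 hf.differentiableOn,
      (continuousOn_dslope (Filter.mem_of_superset (hopen.mem_nhds hs) subset_closure)).2
        ⟨hf.continuousOn, hf.differentiableAt hopen hs⟩⟩
  have hrect : ∀ T : ℝ, (∫ x in a..b, dslope f s (x + ((-T : ℝ) : ℂ) * I)) -
      (∫ x in a..b, dslope f s (x + (T : ℂ) * I)) +
      (I • ∫ y in (-T)..T, dslope f s (b + y * I)) -
      (I • ∫ y in (-T)..T, dslope f s (a + y * I)) = 0 := by
    intro T
    have h := integral_boundary_rect_eq_zero_of_continuousOn_of_differentiableOn (dslope f s)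
      (a + ((-T : ℝ) : ℂ) * I) (b + (T : ℂ) * I)
      (hdslope.continuousOn.mono fun z hz => by
        simpa [hclosure, uIcc_of_le hab.le] using hz.1)
      (hdslope.differentiableOn.mono fun z hz => by
        simpa [min_eq_left hab.le, max_eq_right hab.le] using hz.1)
    simpa using h
  have hs' := Ioo_subset_Icc_self hs
  have hbot := (tendsto_integral_dslope_horizontal hs' hM).comp
    (tendsto_neg_atTop_atBot.mono_right atBot_le_cocompact)
  have htop := (tendsto_integral_dslope_horizontal hs' hM).mono_left atTop_le_cocompact
  have hright := tendsto_integral_dslope_vertical hs.2.ne hfb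
    (tendsto_integral_inv_vertical_of_re_lt hs.2)
  have hleft := tendsto_integral_dslope_vertical hs.1.ne' hfa
    (tendsto_integral_inv_vertical_of_lt_re hs.1)
  have hzero := tendsto_nhds_unique (((hbot.sub htop).add hright).sub hleft)
    (tendsto_const_nhds.congr fun T => (hrect T).symm)
  linear_combination hzero

end CauchyFormulaStrip

section AngularIntegral

variable {r s w : ℂ}

lemma one_sub_mul_ne_zero_of_norm_lt_one {z : ℂ} (hr : ‖r‖ < 1) (hz : ‖z‖ ≤ 1) :
    1 - r * z ≠ 0 := by
  intro h
  have hnorm : ‖r * z‖ = 1 := by rw [← sub_eq_zero.1 h, norm_one]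
  rw [norm_mul] at hnorm
  nlinarith [norm_nonneg r]

lemma integral_inv_one_sub_mul_exp (hr : ‖r‖ < 1) :
    ∫ θ in (-Real.pi)..Real.pi, (1 - r * exp (θ * I))⁻¹ = 2 * (Real.pi : ℂ) := by
  have hdiff : DifferentiableOn ℂ (fun z => (1 - r * z)⁻¹) (Metric.closedBall 0 |1|) :=
    DifferentiableOn.fun_inv (by fun_prop) fun z hz =>
      one_sub_mul_ne_zero_of_norm_lt_one hr (by simpa using hz)
  have hmean := (hdiff.diffContOnCl_ball subset_rfl).circleAverage
  have hperiodic : Function.Periodic (fun θ : ℝ => (1 - r * circleMap 0 1 θ)⁻¹) (2 * Real.pi) :=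
    fun θ => by simp only [periodic_circleMap 0 1 θ]
  have hshift := hperiodic.intervalIntegral_add_eq 0 (-Real.pi)
  rw [zero_add, show -Real.pi + 2 * Real.pi = Real.pi by ring] at hshift
  rw [Real.circleAverage_def, hshift, inv_smul_eq_iff₀ Real.two_pi_pos.ne'] at hmean
  simpa [circleMap] using hmean

lemma poissonKernel_eq_add (hr : ‖r‖ < 1) (θ : ℝ) :
    (1 - r ^ 2) / (1 - 2 * r * Real.cos θ + r ^ 2) =
      (1 - r * exp (θ * I))⁻¹ + (1 - r * exp ((-θ : ℝ) * I))⁻¹ - 1 := by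
  have hne : ∀ x : ℝ, 1 - r * exp (x * I) ≠ 0 := fun x =>
    one_sub_mul_ne_zero_of_norm_lt_one hr (norm_exp_ofReal_mul_I x).le
  have hmul : exp (θ * I) * exp ((-θ : ℝ) * I) = 1 := by rw [← Complex.exp_add]; simp
  have hcos : (Real.cos θ : ℂ) = (exp (θ * I) + exp ((-θ : ℝ) * I)) / 2 := by
    rw [ofReal_cos, Complex.cos, ofReal_neg]
  have hfactor : 1 - 2 * r * Real.cos θ + r ^ 2 =
      (1 - r * exp (θ * I)) * (1 - r * exp ((-θ : ℝ) * I)) := by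
    rw [hcos]
    linear_combination -r ^ 2 * hmul
  have hne₁ := hne θ
  have hne₂ := hne (-θ)
  rw [hfactor]
  generalize exp (θ * I) = z at *
  generalize exp ((-θ : ℝ) * I) = z' at *
  field_simp
  linear_combination r ^ 2 * hmul

lemma integral_poissonKernel (hr : ‖r‖ < 1) :
    ∫ θ in (-Real.pi)..Real.pi, (1 - r ^ 2) / (1 - 2 * r * Real.cos θ + r ^ 2) =
      2 * (Real.pi : ℂ) := by
  have hcont : Continuous fun θ : ℝ => (1 - r * exp (θ * I))⁻¹ :=
    Continuous.inv₀ (by fun_prop) fun θ =>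
      one_sub_mul_ne_zero_of_norm_lt_one hr (norm_exp_ofReal_mul_I θ).le
  have hcont_neg : Continuous fun θ : ℝ => (1 - r * exp ((-θ : ℝ) * I))⁻¹ :=
    hcont.comp continuous_neg
  have hneg := intervalIntegral.integral_comp_neg (a := -Real.pi) (b := Real.pi)
    fun θ : ℝ => (1 - r * exp (θ * I))⁻¹
  rw [neg_neg, integral_inv_one_sub_mul_exp hr] at hneg
  simp_rw [poissonKernel_eq_add hr]
  rw [intervalIntegral.integral_sub ((hcont.fun_add hcont_neg).intervalIntegrable _ _)
      intervalIntegrable_const,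
    intervalIntegral.integral_add (hcont.intervalIntegrable _ _)
      (hcont_neg.intervalIntegrable _ _), hneg, integral_inv_one_sub_mul_exp hr]
  simp only [intervalIntegral.integral_const, sub_neg_eq_add, real_smul, mul_one, ofReal_add]
  ring

-- With `r = -s / (1 + w)` the integrand is `w⁻¹` times the Poisson kernel of radius `r`.
lemma integral_inv_one_add_mul_cos (hw : 0 < w.re) (hsq : w ^ 2 = 1 - s ^ 2) :
    ∫ θ in (-Real.pi)..Real.pi, 1 / (1 + s * (Real.cos θ : ℂ)) = 2 * Real.pi / w := by
  have hw0 : w ≠ 0 := ne_zero_of_re_pos hw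
  have hw1 : 1 + w ≠ 0 := ne_zero_of_re_pos (by simp only [add_re, one_re]; linarith)
  set r := -s / (1 + w) with hr
  have hr_sq : r ^ 2 = (1 - w) / (1 + w) := by
    rw [hr]
    field_simp
    linear_combination hsq
  have hr_lt : ‖r‖ < 1 := by
    have hlt : ‖1 - w‖ < ‖1 + w‖ := by
      rw [← sq_lt_sq₀ (norm_nonneg _) (norm_nonneg _), ← normSq_eq_norm_sq, ← normSq_eq_norm_sq,
        normSq_apply, normSq_apply]
      simp only [sub_re, add_re, one_re, sub_im, add_im, one_im]
      nlinarith
    rw [← sq_lt_one_iff₀ (norm_nonneg r), ← norm_pow, hr_sq, norm_div,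
      div_lt_one (norm_pos_iff.2 hw1)]
    exact hlt
  have hkernel : ∀ θ : ℝ, 1 / (1 + s * (Real.cos θ : ℂ)) =
      w⁻¹ * ((1 - r ^ 2) / (1 - 2 * r * Real.cos θ + r ^ 2)) := by
    intro θ
    have hden : 1 + s * (Real.cos θ : ℂ) = (1 + w) / 2 * (1 - 2 * r * Real.cos θ + r ^ 2) := by
      rw [hr_sq, hr]
      field_simp
      ring
    have hnum : (1 - r ^ 2) * (1 + w) = 2 * w := by
      rw [hr_sq]
      field_simp
      ring
    rw [hden, ← div_div, eq_div_of_mul_eq hw1 hnum]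
    field_simp
  simp_rw [hkernel]
  rw [intervalIntegral.integral_const_mul, integral_poissonKernel hr_lt, inv_mul_eq_div]

end AngularIntegral

section Kappa

variable {ω b c : ℝ} {s : ℂ}

/-- The square root `√(1 - s²)` with positive real part on the strip `|Re s| < 1`; the branch
of `√(s² - 1)` used in `kappa` is `i` times this one, and half-plane estimates are more direct
for `stripSqrt`. -/
noncomputable def stripSqrt (s : ℂ) : ℂ := (1 - s) ^ (1 / 2 : ℂ) * (1 + s) ^ (1 / 2 : ℂ)

lemma branchSqrt_eq (s : ℂ) : branchSqrt s = I * stripSqrt s := rfl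

lemma re_one_sub_pos (hs : |s.re| < 1) : 0 < (1 - s).re := by
  simpa using (abs_lt.1 hs).2

lemma re_one_add_pos (hs : |s.re| < 1) : 0 < (1 + s).re := by
  simpa [neg_lt_iff_pos_add'] using (abs_lt.1 hs).1

lemma stripSqrt_sq (s : ℂ) : stripSqrt s ^ 2 = 1 - s ^ 2 := by
  have hsq (z : ℂ) : (z ^ (1 / 2 : ℂ)) ^ 2 = z := by simp
  rw [stripSqrt, mul_pow, hsq, hsq]
  ring

lemma stripSqrt_neg (s : ℂ) : stripSqrt (-s) = stripSqrt s := by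
  simp only [stripSqrt, sub_neg_eq_add, ← sub_eq_add_neg, mul_comm]

-- Both factors have argument of absolute value less than `π / 4`.
lemma stripSqrt_re_pos (hs : |s.re| < 1) : 0 < (stripSqrt s).re := by
  have harg₁ := abs_lt.1 (abs_arg_lt_pi_div_two_iff.2 (Or.inl (re_one_sub_pos hs)))
  have harg₂ := abs_lt.1 (abs_arg_lt_pi_div_two_iff.2 (Or.inl (re_one_add_pos hs)))
  have him : (log (1 - s) * (1 / 2) + log (1 + s) * (1 / 2)).im =
      (arg (1 - s) + arg (1 + s)) / 2 := by
    have hhalf : (1 / 2 : ℂ) = ((1 / 2 : ℝ) : ℂ) := by push_cast; rfl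
    rw [hhalf, add_im, im_mul_ofReal, im_mul_ofReal, log_im, log_im]
    ring
  rw [stripSqrt, cpow_def_of_ne_zero (ne_zero_of_re_pos (re_one_sub_pos hs)),
    cpow_def_of_ne_zero (ne_zero_of_re_pos (re_one_add_pos hs)), ← Complex.exp_add, exp_re, him]
  refine mul_pos (Real.exp_pos _) (Real.cos_pos_of_mem_Ioo ⟨?_, ?_⟩) <;> linarith

lemma stripSqrt_ne_zero (hs : |s.re| < 1) : stripSqrt s ≠ 0 :=
  ne_zero_of_re_pos (stripSqrt_re_pos hs)

lemma differentiableAt_stripSqrt (hs : |s.re| < 1) : DifferentiableAt ℂ stripSqrt s :=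
  (DifferentiableAt.cpow (by fun_prop) (by fun_prop) (Or.inl (re_one_sub_pos hs))).mul
    (DifferentiableAt.cpow (by fun_prop) (by fun_prop) (Or.inl (re_one_add_pos hs)))

lemma one_sub_sq_add_sq_le_sq_norm_stripSqrt (s : ℂ) :
    1 - s.re ^ 2 + s.im ^ 2 ≤ ‖stripSqrt s‖ ^ 2 := by
  rw [← norm_pow, stripSqrt_sq]
  refine le_trans (le_of_eq ?_) (re_le_norm _)
  simp only [sub_re, one_re, sq, mul_re]
  ring

lemma integral_angular (hs : |s.re| < 1) :
    ∫ θ in (-Real.pi)..Real.pi, 1 / (1 + s * (Real.cos θ : ℂ)) =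
      2 * (Real.pi : ℂ) * I / branchSqrt s := by
  rw [integral_inv_one_add_mul_cos (stripSqrt_re_pos hs) (stripSqrt_sq s), branchSqrt_eq,
    mul_comm (2 * (Real.pi : ℂ)) I, mul_div_mul_left _ _ I_ne_zero]

lemma sPlus_nonneg (ω : ℝ) : 0 ≤ sPlus ω := Real.sqrt_nonneg _

lemma sPlus_le_one (ω : ℝ) : sPlus ω ≤ 1 := Real.sqrt_le_one.2 (by nlinarith [sq_nonneg ω])

lemma sPlus_sq (hω : 0 < sPlus ω) : sPlus ω ^ 2 = 1 - ω ^ 2 :=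
  Real.sq_sqrt (Real.sqrt_pos.1 hω).le

lemma sq_norm_div_stripSqrt_le (hb : b < sPlus ω) (hs : |s.re| ≤ b) :
    ‖(ω : ℂ) / stripSqrt s‖ ^ 2 ≤ ω ^ 2 / (1 - b ^ 2) * (1 + s.im ^ 2)⁻¹ := by
  have hb0 : 0 ≤ b := (abs_nonneg _).trans hs
  have hb1 : b < 1 := hb.trans_le (sPlus_le_one ω)
  have hb_sq : 0 < 1 - b ^ 2 := by nlinarith
  have hre : s.re ^ 2 ≤ b ^ 2 := by rw [← sq_abs s.re]; gcongr
  have hw : (1 - b ^ 2) * (1 + s.im ^ 2) ≤ ‖stripSqrt s‖ ^ 2 := by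
    nlinarith [one_sub_sq_add_sq_le_sq_norm_stripSqrt s, mul_nonneg (sq_nonneg b) (sq_nonneg s.im)]
  rw [norm_div, div_pow, norm_real, Real.norm_eq_abs, sq_abs, ← div_eq_mul_inv, div_div]
  gcongr

lemma sq_div_one_sub_sq_lt_one (hb0 : 0 ≤ b) (hb : b < sPlus ω) : ω ^ 2 / (1 - b ^ 2) < 1 := by
  have hlt : b ^ 2 < sPlus ω ^ 2 := by gcongr
  rw [sPlus_sq (hb0.trans_lt hb)] at hlt
  rw [div_lt_one (by nlinarith [sq_nonneg ω])]
  linarith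

lemma norm_div_stripSqrt_lt_one (hs : |s.re| < sPlus ω) : ‖(ω : ℂ) / stripSqrt s‖ < 1 := by
  rw [← sq_lt_one_iff₀ (norm_nonneg _)]
  refine (sq_norm_div_stripSqrt_le hs le_rfl).trans_lt
    ((mul_le_of_le_one_right ?_ ?_).trans_lt (sq_div_one_sub_sq_lt_one (abs_nonneg _) hs))
  · exact div_nonneg (sq_nonneg ω) (by nlinarith [abs_nonneg s.re, hs.trans_le (sPlus_le_one ω)])
  · exact inv_le_one_of_one_le₀ (by nlinarith [sq_nonneg s.im])

lemma re_one_add_div_stripSqrt_pos (hs : |s.re| < sPlus ω) :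
    0 < (1 + (ω : ℂ) / stripSqrt s).re := by
  have := (abs_le.1 (abs_re_le_norm ((ω : ℂ) / stripSqrt s))).1
  rw [add_re, one_re]
  linarith [norm_div_stripSqrt_lt_one hs]

lemma sq_sub_sPlus_sq_ne_zero (hs : |s.re| < sPlus ω) : s ^ 2 - (sPlus ω : ℂ) ^ 2 ≠ 0 := by
  rw [sub_ne_zero]
  intro h
  rcases sq_eq_sq_iff_eq_or_eq_neg.1 h with rfl | rfl
  · exact (le_abs_self _).not_gt hs
  · exact (le_abs_self _).not_gt (by simpa using hs)

-- Since `1 - (ω / w)² = (s² - s₊²) / (s² - 1)` for `w = √(1 - s²)`, this links the kernel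
-- `1 - ω / w` of the transformed transport equation to `κ = (1 + ω / w)⁻¹`.
lemma one_sub_div_stripSqrt (hs : |s.re| < sPlus ω) :
    1 - (ω : ℂ) / stripSqrt s =
      (1 + (ω : ℂ) / stripSqrt s)⁻¹ * ((s ^ 2 - (sPlus ω : ℂ) ^ 2) / (s ^ 2 - 1)) := by
  have hw := stripSqrt_ne_zero (hs.trans_le (sPlus_le_one ω))
  have hplus := ne_zero_of_re_pos (re_one_add_div_stripSqrt_pos hs)
  have hden : s ^ 2 - 1 = -stripSqrt s ^ 2 := by rw [stripSqrt_sq]; ring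
  have hnum : s ^ 2 - (sPlus ω : ℂ) ^ 2 = (ω : ℂ) ^ 2 - stripSqrt s ^ 2 := by
    have hsPlus : (sPlus ω : ℂ) ^ 2 = 1 - (ω : ℂ) ^ 2 := by
      exact_mod_cast sPlus_sq ((abs_nonneg _).trans_lt hs)
    rw [stripSqrt_sq, hsPlus]
    ring
  rw [hden, hnum, eq_inv_mul_iff_mul_eq₀ hplus]
  field_simp
  ring

lemma kappa_eq (hs : |s.re| < sPlus ω) : kappa ω s = (1 + (ω : ℂ) / stripSqrt s)⁻¹ := by
  have hw := stripSqrt_ne_zero (hs.trans_le (sPlus_le_one ω))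
  have hnum := sq_sub_sPlus_sq_ne_zero hs
  have hden : s ^ 2 - 1 ≠ 0 := by
    rw [← neg_sub, ← stripSqrt_sq]
    exact neg_ne_zero.2 (pow_ne_zero _ hw)
  have hkappa : kappa ω s =
      (1 - (ω : ℂ) / stripSqrt s) * ((s ^ 2 - 1) / (s ^ 2 - (sPlus ω : ℂ) ^ 2)) := by
    rw [kappa, branchSqrt_eq]
    field_simp
  rw [hkappa, one_sub_div_stripSqrt hs]
  field_simp

lemma kappa_neg (ω : ℝ) (s : ℂ) : kappa ω (-s) = kappa ω s := by
  simp only [kappa, branchSqrt_eq, stripSqrt_neg, neg_sq]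

lemma kappa_ne_zero (hs : |s.re| < sPlus ω) : kappa ω s ≠ 0 := by
  rw [kappa_eq hs]
  exact inv_ne_zero (ne_zero_of_re_pos (re_one_add_div_stripSqrt_pos hs))

lemma log_kappa (hs : |s.re| < sPlus ω) :
    log (kappa ω s) = -log (1 + (ω : ℂ) / stripSqrt s) := by
  rw [kappa_eq hs, log_inv _ (mem_slitPlane_iff_arg.1
    (Or.inl (re_one_add_div_stripSqrt_pos hs))).1]

lemma differentiableOn_log_kappa (ω : ℝ) :
    DifferentiableOn ℂ (fun s => log (kappa ω s)) {s | |s.re| < sPlus ω} := by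
  refine DifferentiableOn.congr (f := fun s => -log (1 + (ω : ℂ) / stripSqrt s)) ?_
    fun s hs => log_kappa hs
  intro s hs
  have hs1 : |s.re| < 1 := lt_of_lt_of_le hs (sPlus_le_one ω)
  exact (((((differentiableAt_const _).div (differentiableAt_stripSqrt hs1)
    (stripSqrt_ne_zero hs1)).const_add 1).clog
      (Or.inl (re_one_add_div_stripSqrt_pos hs))).neg).differentiableWithinAt

lemma norm_log_one_add_le_div {u : ℂ} {q : ℝ} (hu : ‖u‖ ≤ q) (hq : q < 1) :
    ‖log (1 + u)‖ ≤ ‖u‖ / (1 - q) := by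
  have hu1 : ‖u‖ < 1 := hu.trans_lt hq
  calc ‖log (1 + u)‖ ≤ ‖u‖ ^ 2 * (1 - ‖u‖)⁻¹ / 2 + ‖u‖ := norm_log_one_add_le hu1
    _ ≤ ‖u‖ / (1 - ‖u‖) := by
      have : 0 < 1 - ‖u‖ := sub_pos.2 hu1
      field_simp
      nlinarith [norm_nonneg u]
    _ ≤ ‖u‖ / (1 - q) := by
      have : 0 < 1 - q := sub_pos.2 hq
      gcongr

lemma exists_sq_norm_log_kappa_le (hb0 : 0 ≤ b) (hb : b < sPlus ω) :
    ∃ C, ∀ s : ℂ, |s.re| ≤ b → ‖log (kappa ω s)‖ ^ 2 ≤ C * (1 + s.im ^ 2)⁻¹ := by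
  set p := ω ^ 2 / (1 - b ^ 2)
  have hp0 : 0 ≤ p := div_nonneg (sq_nonneg ω) (by nlinarith [hb.trans_le (sPlus_le_one ω)])
  have hp1 : √p < 1 := by
    rw [Real.sqrt_lt' one_pos, one_pow]
    exact sq_div_one_sub_sq_lt_one hb0 hb
  refine ⟨p / (1 - √p) ^ 2, fun s hs => ?_⟩
  have hu := sq_norm_div_stripSqrt_le hb hs
  have hu' : ‖(ω : ℂ) / stripSqrt s‖ ≤ √p := Real.le_sqrt_of_sq_le
    (hu.trans (mul_le_of_le_one_right hp0 (inv_le_one_of_one_le₀ (by nlinarith [sq_nonneg s.im]))))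
  rw [log_kappa (hs.trans_lt hb), norm_neg]
  calc ‖log (1 + (ω : ℂ) / stripSqrt s)‖ ^ 2
      ≤ (‖(ω : ℂ) / stripSqrt s‖ / (1 - √p)) ^ 2 := by
        gcongr
        exact norm_log_one_add_le_div hu' hp1
    _ ≤ p * (1 + s.im ^ 2)⁻¹ / (1 - √p) ^ 2 := by
        rw [div_pow]
        gcongr
    _ = p / (1 - √p) ^ 2 * (1 + s.im ^ 2)⁻¹ := by ring

lemma memLp_log_kappa_vertical (hc : |c| < sPlus ω) :
    MemLp (fun t : ℝ => log (kappa ω (c + I * t))) 2 := by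
  have hcont : Continuous fun t : ℝ => log (kappa ω (c + I * t)) :=
    (differentiableOn_log_kappa ω).continuousOn.comp_continuous (by fun_prop) fun t => by
      simpa using hc
  obtain ⟨C, hC⟩ := exists_sq_norm_log_kappa_le (abs_nonneg c) hc
  rw [memLp_two_iff_integrable_sq_norm hcont.aestronglyMeasurable]
  refine (integrable_inv_one_add_sq.const_mul C).mono'
    (hcont.norm.pow 2).aestronglyMeasurable (ae_of_all _ fun t => ?_)
  simpa using hC (c + I * t) (by simp)

lemma exists_norm_log_kappa_le (hb0 : 0 ≤ b) (hb : b < sPlus ω) :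
    ∃ M, ∀ s : ℂ, |s.re| ≤ b → ‖log (kappa ω s)‖ ≤ M := by
  obtain ⟨C, hC⟩ := exists_sq_norm_log_kappa_le hb0 hb
  have hC0 : 0 ≤ C := by simpa using (sq_nonneg _).trans (hC 0 (by simpa))
  exact ⟨√C, fun s hs => Real.le_sqrt_of_sq_le ((hC s hs).trans (mul_le_of_le_one_right hC0
    (inv_le_one_of_one_le₀ (by nlinarith [sq_nonneg s.im]))))⟩

end Kappa

section WienerHopfFactors

variable {ω β c d : ℝ} {s : ℂ}

lemma integrable_contourIntegrand (hc : |c| < sPlus ω) (hs : s.re ≠ c) :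
    Integrable (contourIntegrand ω c s) := by
  unfold contourIntegrand
  exact integrable_cauchyIntegrand (f := fun z => log (kappa ω z)) (memLp_log_kappa_vertical hc) hs

lemma cauchyExp_eq (ω c : ℝ) (s : ℂ) : cauchyExp ω c s =
    exp (1 / (2 * Real.pi * I) * verticalCauchyIntegral (fun z => log (kappa ω z)) c s) := rfl

lemma cauchyExp_ne_zero (ω c : ℝ) (s : ℂ) : cauchyExp ω c s ≠ 0 := exp_ne_zero _

lemma differentiableAt_cauchyExp (hc : |c| < sPlus ω) (hs : s.re ≠ c) :
    DifferentiableAt ℂ (cauchyExp ω c) s := by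
  rw [funext (cauchyExp_eq ω c)]
  exact ((differentiableAt_verticalCauchyIntegral (f := fun z => log (kappa ω z))
    (memLp_log_kappa_vertical hc) hs).const_mul _).cexp

lemma cauchyExp_neg (ω c : ℝ) (s : ℂ) : cauchyExp ω (-c) (-s) = (cauchyExp ω c s)⁻¹ := by
  rw [cauchyExp_eq, cauchyExp_eq, verticalCauchyIntegral_neg (fun z => by rw [kappa_neg]), mul_neg,
    Complex.exp_neg]

lemma kappaMinus_eq (ω β : ℝ) (s : ℂ) : kappaMinus ω β s = (kappaPlus ω β (-s))⁻¹ := by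
  rw [kappaMinus, kappaPlus, ← cauchyExp_neg, neg_neg]

lemma exists_norm_cauchyExp_le (hc : |c| < sPlus ω) (hd : 0 < d) :
    ∃ C : ℝ, ∀ s : ℂ, d ≤ |c - s.re| → ‖cauchyExp ω c s‖ ≤ C := by
  refine ⟨Real.exp (‖1 / (2 * Real.pi * I)‖ *
    (((∫ t : ℝ, ‖log (kappa ω (c + I * t))‖ ^ 2) + Real.pi / d) / 2)), fun s hs => ?_⟩
  rw [cauchyExp_eq]
  refine (norm_exp_le_exp_norm _).trans (Real.exp_le_exp.2 ?_)
  rw [norm_mul]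
  gcongr
  exact norm_verticalCauchyIntegral_le (memLp_log_kappa_vertical hc) hd hs

lemma exists_norm_inv_cauchyExp_le (hc : |c| < sPlus ω) (hd : 0 < d) :
    ∃ C : ℝ, ∀ s : ℂ, d ≤ |c - s.re| → ‖(cauchyExp ω c s)⁻¹‖ ≤ C := by
  obtain ⟨C, hC⟩ := exists_norm_cauchyExp_le (c := -c) (by rwa [abs_neg]) hd
  refine ⟨C, fun s hs => ?_⟩
  rw [← cauchyExp_neg]
  refine hC (-s) ?_
  rwa [neg_re, neg_sub_neg, abs_sub_comm]

lemma kappa_eq_div (hβ : β < sPlus ω) (hs : |s.re| < β) :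
    kappa ω s = kappaPlus ω β s / kappaMinus ω β s := by
  have hβ0 : 0 < β := (abs_nonneg _).trans_lt hs
  have hβ_abs : |β| < sPlus ω := by rwa [abs_of_pos hβ0]
  have hs' := abs_lt.1 hs
  have hdiff : DiffContOnCl ℂ (fun z => log (kappa ω z)) (re ⁻¹' Ioo (-β) β) := by
    refine ((differentiableOn_log_kappa ω).mono fun z hz => ?_).diffContOnCl
    rw [closure_preimage_re, closure_Ioo (by linarith)] at hz
    exact (abs_le.2 hz).trans_lt hβ
  obtain ⟨M, hM⟩ := exists_norm_log_kappa_le hβ0.le hβ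
  have hcauchy := verticalCauchyIntegral_sub_eq hdiff (fun z hz => hM z (abs_le.2 hz)) hs'
    (integrable_contourIntegrand (by rwa [abs_neg]) hs'.1.ne')
    (integrable_contourIntegrand hβ_abs hs'.2.ne)
  rw [kappaPlus, kappaMinus, cauchyExp_eq, cauchyExp_eq, ← Complex.exp_sub, ← mul_sub, hcauchy,
    ← mul_assoc, one_div, inv_mul_cancel₀ two_pi_I_ne_zero, one_mul,
    exp_log (kappa_ne_zero (hs.trans hβ))]

end WienerHopfFactors

section Laplace

variable {f f' : ℝ → ℝ} {σ : ℝ} {s : ℂ}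

lemma integrable_cexp_mul_ofReal {α : Type*} {_ : MeasurableSpace α} {ν : Measure α}
    {g f : α → ℝ} (hg : Measurable g) (hg0 : ∀ᵐ a ∂ν, 0 ≤ g a)
    (hf : Integrable (fun a => Real.exp (-σ * g a) * f a) ν) (hs : σ ≤ s.re) :
    Integrable (fun a => exp (-s * (g a : ℂ)) * (f a : ℂ)) ν := by
  have hbdd : ∀ᵐ a ∂ν, ‖exp (-(s - σ) * (g a : ℂ))‖ ≤ 1 := by
    filter_upwards [hg0] with a ha
    rw [norm_exp, Real.exp_le_one_iff, re_mul_ofReal, neg_re, sub_re, ofReal_re]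
    exact mul_nonpos_of_nonpos_of_nonneg (by linarith) ha
  refine (hf.ofReal.bdd_mul (by fun_prop) hbdd).congr (ae_of_all _ fun a => ?_)
  simp only [coe_algebraMap]
  rw [ofReal_mul, ofReal_exp, ← mul_assoc, ← Complex.exp_add]
  congr 2
  push_cast
  ring

lemma norm_laplaceIntegrand_le (hs : σ ≤ s.re) {τ : ℝ} (hτ : 0 ≤ τ) :
    ‖exp (-s * (τ : ℂ)) * (f τ : ℂ)‖ ≤ ‖Real.exp (-σ * τ) * f τ‖ := by
  rw [norm_mul, norm_mul, norm_exp, norm_real, Real.norm_of_nonneg (Real.exp_pos _).le,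
    re_mul_ofReal, neg_re]
  gcongr

lemma integrableOn_laplaceIntegrand
    (hf : IntegrableOn (fun τ => Real.exp (-σ * τ) * f τ) (Ioi 0)) (hs : σ ≤ s.re) :
    IntegrableOn (fun τ : ℝ => exp (-s * (τ : ℂ)) * (f τ : ℂ)) (Ioi 0) :=
  integrable_cexp_mul_ofReal measurable_id
    ((ae_restrict_mem measurableSet_Ioi).mono fun _ hτ => (mem_Ioi.1 hτ).le) hf hs

lemma norm_laplace_le (hf : IntegrableOn (fun τ => Real.exp (-σ * τ) * f τ) (Ioi 0))
    (hs : σ ≤ s.re) : ‖laplace f s‖ ≤ ∫ τ in Ioi (0 : ℝ), ‖Real.exp (-σ * τ) * f τ‖ :=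
  norm_integral_le_of_norm_le hf.norm ((ae_restrict_mem measurableSet_Ioi).mono
    fun _ hτ => norm_laplaceIntegrand_le hs (mem_Ioi.1 hτ).le)

lemma differentiableAt_laplace (hf : IntegrableOn (fun τ => Real.exp (-σ * τ) * f τ) (Ioi 0))
    (hs : σ < s.re) : DifferentiableAt ℂ (laplace f) s := by
  refine differentiableAt_integral_of_dominated
    ((isOpen_lt continuous_const continuous_re).mem_nhds hs)
    (fun z hz => (integrableOn_laplaceIntegrand hf (le_of_lt hz)).aestronglyMeasurable)
    ((ae_restrict_mem measurableSet_Ioi).mono fun τ hτ z hz =>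
      norm_laplaceIntegrand_le (le_of_lt hz) (mem_Ioi.1 hτ).le) hf.norm
    (ae_of_all _ fun τ => ?_)
  fun_prop

lemma tendsto_laplace_atTop (hf : IntegrableOn (fun τ => Real.exp (-σ * τ) * f τ) (Ioi 0)) :
    Tendsto (fun x : ℝ => laplace f x) atTop (𝓝 0) := by
  have hlim : ∀ᵐ τ : ℝ ∂volume.restrict (Ioi (0 : ℝ)),
      Tendsto (fun x : ℝ => exp (-(x : ℂ) * (τ : ℂ)) * (f τ : ℂ)) atTop (𝓝 0) := by
    filter_upwards [ae_restrict_mem measurableSet_Ioi] with τ hτ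
    rw [tendsto_zero_iff_norm_tendsto_zero]
    simp only [norm_mul, norm_exp, re_mul_ofReal, neg_re, ofReal_re, neg_mul]
    simpa using (Real.tendsto_exp_neg_atTop_nhds_zero.comp
      (tendsto_id.atTop_mul_const (mem_Ioi.1 hτ))).mul_const ‖(f τ : ℂ)‖
  simpa [laplace] using tendsto_integral_filter_of_dominated_convergence
    (fun τ => ‖Real.exp (-σ * τ) * f τ‖)
    ((eventually_ge_atTop σ).mono fun x hx =>
      (integrableOn_laplaceIntegrand (s := x) hf (by simpa using hx)).aestronglyMeasurable)
    ((eventually_ge_atTop σ).mono fun x hx => (ae_restrict_mem measurableSet_Ioi).mono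
      fun τ hτ => norm_laplaceIntegrand_le (by simpa using hx) (mem_Ioi.1 hτ).le)
    hf.norm hlim

lemma laplace_of_hasDerivAt (hcont : ContinuousWithinAt f (Ici 0) 0)
    (hderiv : ∀ τ ∈ Ioi (0 : ℝ), HasDerivAt f (f' τ) τ)
    (hf : IntegrableOn (fun τ : ℝ => exp (-s * (τ : ℂ)) * (f τ : ℂ)) (Ioi 0))
    (hf' : IntegrableOn (fun τ : ℝ => exp (-s * (τ : ℂ)) * (f' τ : ℂ)) (Ioi 0)) :
    laplace f' s = s * laplace f s - f 0 := by
  have hprod : ∀ τ ∈ Ioi (0 : ℝ), HasDerivAt (fun τ : ℝ => exp (-s * (τ : ℂ)) * (f τ : ℂ))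
      (exp (-s * (τ : ℂ)) * (f' τ : ℂ) - s * (exp (-s * (τ : ℂ)) * (f τ : ℂ))) τ := by
    intro τ hτ
    have hexp : HasDerivAt (fun τ : ℝ => exp (-s * (τ : ℂ))) (exp (-s * (τ : ℂ)) * -s) τ := by
      simpa using (((hasDerivAt_id (τ : ℂ)).const_mul (-s)).cexp).comp_ofReal
    refine (hexp.mul (hderiv τ hτ).ofReal_comp).congr_deriv ?_
    ring
  have hcont' : ContinuousWithinAt (fun τ : ℝ => exp (-s * (τ : ℂ)) * (f τ : ℂ)) (Ici 0) 0 :=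
    ContinuousWithinAt.mul (by fun_prop)
      (continuous_ofReal.continuousAt.comp_continuousWithinAt hcont)
  have hint := hf'.sub (hf.const_mul s)
  have hftc := integral_Ioi_of_hasDerivAt_of_tendsto hcont' hprod hint
    (tendsto_zero_of_hasDerivAt_of_integrableOn_Ioi hprod hint hf)
  rw [integral_sub hf' (hf.const_mul s), integral_const_mul] at hftc
  simp only [ofReal_zero, mul_zero, Complex.exp_zero, one_mul] at hftc
  rw [laplace, laplace]
  linear_combination hftc

lemma integrableOn_exp_neg_div {μ σ : ℝ} (hμ : 0 < μ) (hσ : 0 < σ) :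
    IntegrableOn (fun τ => Real.exp (-σ * τ) * Real.exp (-τ / μ)) (Ioi 0) := by
  have hexp (τ : ℝ) : Real.exp (-σ * τ) * Real.exp (-τ / μ) = Real.exp (-(σ + 1 / μ) * τ) := by
    rw [← Real.exp_add]
    congr 1
    ring
  simp only [hexp]
  exact integrableOn_exp_mul_Ioi (neg_lt_zero.2 (by positivity)) 0

lemma laplace_exp_neg_div {μ : ℝ} (hμ : μ ≠ 0) (hs : 0 < s.re + 1 / μ) :
    laplace (fun τ => Real.exp (-τ / μ)) s = μ / (1 + μ * s) := by
  have hμ' : (μ : ℂ) ≠ 0 := ofReal_ne_zero.2 hμ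
  have hre : 0 < (s + ((1 / μ : ℝ) : ℂ)).re := by rwa [add_re, ofReal_re]
  have hfactor : 1 + μ * s = μ * (s + ((1 / μ : ℝ) : ℂ)) := by
    push_cast
    field_simp
    ring
  have hexp (τ : ℝ) : exp (-s * (τ : ℂ)) * (Real.exp (-τ / μ) : ℂ) =
      exp (-(s + ((1 / μ : ℝ) : ℂ)) * (τ : ℂ)) := by
    rw [ofReal_exp, ← Complex.exp_add]
    congr 1
    push_cast
    ring
  simp only [laplace, hexp]
  rw [integral_exp_mul_complex_Ioi (by rwa [neg_re, neg_lt_zero]) 0, hfactor,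
    div_mul_cancel_left₀ hμ', ofReal_zero, mul_zero, Complex.exp_zero, neg_div_neg_eq, one_div]

end Laplace

section OutwardIntegral

variable {α : Type*} {_ : MeasurableSpace α} {ν : Measure α} {g : α → ℂ} {c : α → ℝ}
  {m : ℝ} {s : ℂ}

lemma one_sub_le_norm_one_add_mul {x : ℝ} (hx : x ∈ Icc (-1) 0) (hm : 0 ≤ m) (hs : s.re ≤ m) :
    1 - m ≤ ‖1 + s * (x : ℂ)‖ := by
  refine le_trans ?_ (re_le_norm _)
  rw [add_re, one_re, re_mul_ofReal]
  nlinarith [hx.1, hx.2]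

lemma norm_div_one_add_mul_le {x : ℝ} {z : ℂ} (hx : z ≠ 0 → x ∈ Icc (-1) 0) (hm : 0 ≤ m)
    (hm1 : m < 1) (hs : s.re ≤ m) : ‖z / (1 + s * (x : ℂ))‖ ≤ ‖z‖ / (1 - m) := by
  rcases eq_or_ne z 0 with rfl | hz
  · simp
  have := sub_pos.2 hm1
  rw [norm_div]
  gcongr
  exact one_sub_le_norm_one_add_mul (hx hz) hm hs

lemma aestronglyMeasurable_div_one_add_mul (hg : Integrable g ν) (hc : Measurable c) (s : ℂ) :
    AEStronglyMeasurable (fun a => g a / (1 + s * (c a : ℂ))) ν :=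
  (hg.aestronglyMeasurable.aemeasurable.div (by fun_prop)).aestronglyMeasurable

lemma integrable_div_one_add_mul (hg : Integrable g ν) (hc : Measurable c)
    (hgc : ∀ᵐ a ∂ν, g a ≠ 0 → c a ∈ Icc (-1) 0) (hs : s.re < 1) :
    Integrable (fun a => g a / (1 + s * (c a : ℂ))) ν :=
  (hg.norm.div_const (1 - max s.re 0)).mono' (aestronglyMeasurable_div_one_add_mul hg hc s)
    (hgc.mono fun _ ha => norm_div_one_add_mul_le ha (le_max_right _ _)
      (max_lt hs one_pos) (le_max_left _ _))

lemma norm_integral_div_one_add_mul_le (hg : Integrable g ν)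
    (hgc : ∀ᵐ a ∂ν, g a ≠ 0 → c a ∈ Icc (-1) 0) (hm : 0 ≤ m) (hm1 : m < 1) (hs : s.re ≤ m) :
    ‖∫ a, g a / (1 + s * (c a : ℂ)) ∂ν‖ ≤ (∫ a, ‖g a‖ ∂ν) / (1 - m) := by
  rw [← integral_div]
  exact norm_integral_le_of_norm_le (hg.norm.div_const _)
    (hgc.mono fun _ ha => norm_div_one_add_mul_le ha hm hm1 hs)

lemma differentiableAt_integral_div_one_add_mul (hg : Integrable g ν) (hc : Measurable c)
    (hgc : ∀ᵐ a ∂ν, g a ≠ 0 → c a ∈ Icc (-1) 0) (hs : s.re < 1) :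
    DifferentiableAt ℂ (fun z => ∫ a, g a / (1 + z * (c a : ℂ)) ∂ν) s := by
  obtain ⟨m, hm, hm1⟩ : ∃ m, max s.re 0 < m ∧ m < 1 := exists_between (max_lt hs one_pos)
  obtain ⟨hsm, hm0⟩ := max_lt_iff.1 hm
  refine differentiableAt_integral_of_dominated (U := {z : ℂ | z.re < m})
    ((isOpen_lt continuous_re continuous_const).mem_nhds hsm)
    (fun z _ => aestronglyMeasurable_div_one_add_mul hg hc z)
    (hgc.mono fun _ ha z hz => norm_div_one_add_mul_le ha hm0.le hm1 (le_of_lt hz))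
    (hg.norm.div_const _) (hgc.mono fun a ha => ?_)
  rcases eq_or_ne (g a) 0 with hga | hga
  · simp [hga]
  refine (differentiableOn_const _).div (by fun_prop) fun z hz => norm_pos_iff.1 ?_
  exact (sub_pos.2 hm1).trans_le (one_sub_le_norm_one_add_mul (ha hga) hm0.le (le_of_lt hz))

end OutwardIntegral

section Transport

lemma photonDensity_eq_integral_Ioo (ψ : ℝ → ℝ → ℝ) (τ : ℝ) :
    photonDensity ψ τ = ∫ θ in Ioo (-Real.pi) Real.pi, ψ θ τ := by
  rw [photonDensity, intervalIntegral.integral_of_le (by linarith [Real.pi_pos]),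
    integral_Ioc_eq_integral_Ioo]

lemma ae_cos_ne_zero : ∀ᵐ θ : ℝ, Real.cos θ ≠ 0 := by
  have hcountable : {θ : ℝ | Real.cos θ = 0}.Countable := by
    refine (countable_range fun k : ℤ => (2 * (k : ℝ) + 1) * Real.pi / 2).mono fun θ hθ => ?_
    obtain ⟨k, hk⟩ := Real.cos_eq_zero_iff.1 hθ
    exact ⟨k, hk.symm⟩
  simpa [ae_iff] using hcountable.measure_zero volume

lemma cos_nonpos_of_pi_div_two_le_abs {θ : ℝ} (hθ : Real.pi / 2 ≤ |θ|) (hθ' : |θ| < Real.pi) :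
    Real.cos θ ≤ 0 := by
  rw [← Real.cos_abs]
  exact Real.cos_nonpos_of_pi_div_two_le_of_le hθ (by linarith [Real.pi_pos])

lemma neg_inv_ofReal_re_pos {μ : ℝ} (hμ : μ < 0) : 0 < (-1 / (μ : ℂ)).re := by
  rw [div_ofReal_re, neg_re, one_re]
  exact div_pos_of_neg_of_neg neg_one_lt_zero hμ

/-- The total source `ρ_d(τ) + e^{-τ/μ₀}` on the right-hand side of the transport equation, without
the factor `ω / 2π`: light that is scattered again and light scattered out of the incident beam. -/
noncomputable def source (ψ : ℝ → ℝ → ℝ) (μ₀ τ : ℝ) : ℝ :=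
  photonDensity ψ τ + Real.exp (-τ / μ₀)

/-- The contribution `∫ μ ψ_d(θ, 0) / (1 + s μ) dθ` of the flux through the boundary `τ = 0` to the
Laplace transform of the photon density. -/
noncomputable def boundaryTerm (ψ : ℝ → ℝ → ℝ) (s : ℂ) : ℂ :=
  ∫ θ in Ioo (-Real.pi) Real.pi, (Real.cos θ : ℂ) * (ψ θ 0 : ℂ) / (1 + s * (Real.cos θ : ℂ))

namespace IsDiffuseFlux

variable {ω θ₀ σ m θ : ℝ} {ψ : ℝ → ℝ → ℝ} {s : ℂ}

lemma integrable_joint (hψ : IsDiffuseFlux ω θ₀ ψ) (hσ : 0 < σ) :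
    Integrable (fun p : ℝ × ℝ => Real.exp (-σ * p.2) * ψ p.1 p.2)
      ((volume.restrict (Ioo (-Real.pi) Real.pi)).prod (volume.restrict (Ioi (0 : ℝ)))) := by
  rw [Measure.prod_restrict, ← Measure.volume_eq_prod]
  exact hψ.laplace_joint σ hσ

lemma integrable_joint_cexp (hψ : IsDiffuseFlux ω θ₀ ψ) (hs : 0 < s.re) :
    Integrable (fun p : ℝ × ℝ => exp (-s * (p.2 : ℂ)) * (ψ p.1 p.2 : ℂ))
      ((volume.restrict (Ioo (-Real.pi) Real.pi)).prod (volume.restrict (Ioi (0 : ℝ)))) := by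
  refine integrable_cexp_mul_ofReal measurable_snd ?_ (hψ.integrable_joint hs) le_rfl
  exact Measure.quasiMeasurePreserving_snd.ae
    ((ae_restrict_mem measurableSet_Ioi).mono fun _ hτ => (mem_Ioi.1 hτ).le)

lemma integrableOn_photonDensity (hψ : IsDiffuseFlux ω θ₀ ψ) (hσ : 0 < σ) :
    IntegrableOn (fun τ => Real.exp (-σ * τ) * photonDensity ψ τ) (Ioi 0) := by
  simpa only [IntegrableOn, integral_const_mul, ← photonDensity_eq_integral_Ioo] using
    (hψ.integrable_joint hσ).integral_prod_right

lemma integrableOn_laplace_angle (hψ : IsDiffuseFlux ω θ₀ ψ) (hs : 0 < s.re) :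
    IntegrableOn (fun θ => laplace (ψ θ) s) (Ioo (-Real.pi) Real.pi) :=
  (hψ.integrable_joint_cexp hs).integral_prod_left

lemma laplace_photonDensity (hψ : IsDiffuseFlux ω θ₀ ψ) (hs : 0 < s.re) :
    laplace (photonDensity ψ) s = ∫ θ in Ioo (-Real.pi) Real.pi, laplace (ψ θ) s := by
  simp only [laplace]
  rw [integral_integral_swap (hψ.integrable_joint_cexp hs)]
  simp only [integral_const_mul, photonDensity_eq_integral_Ioo, integral_complex_ofReal]

lemma integrableOn_source (hψ : IsDiffuseFlux ω θ₀ ψ) (hθ₀ : 0 < Real.cos θ₀) (hσ : 0 < σ) :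
    IntegrableOn (fun τ => Real.exp (-σ * τ) * source ψ (Real.cos θ₀) τ) (Ioi 0) := by
  simp only [source, mul_add]
  exact (hψ.integrableOn_photonDensity hσ).add (integrableOn_exp_neg_div hθ₀ hσ)

lemma laplace_source (hψ : IsDiffuseFlux ω θ₀ ψ) (hθ₀ : 0 < Real.cos θ₀) (hs : 0 < s.re) :
    laplace (source ψ (Real.cos θ₀)) s =
      laplace (photonDensity ψ) s + (Real.cos θ₀ : ℂ) / (1 + (Real.cos θ₀ : ℂ) * s) := by
  rw [← laplace_exp_neg_div hθ₀.ne' (by positivity)]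
  simp only [laplace, source, ofReal_add, mul_add]
  exact integral_add
    (integrableOn_laplaceIntegrand (hψ.integrableOn_photonDensity hs) le_rfl)
    (integrableOn_laplaceIntegrand (integrableOn_exp_neg_div hθ₀ hs) le_rfl)

lemma hasDerivAt_flux (hψ : IsDiffuseFlux ω θ₀ ψ) (hθ : θ ∈ Ioo (-Real.pi) Real.pi)
    (hcos : Real.cos θ ≠ 0) {τ : ℝ} (hτ : 0 < τ) :
    HasDerivAt (ψ θ) ((Real.cos θ)⁻¹ *
      (ω / (2 * Real.pi) * source ψ (Real.cos θ₀) τ - ψ θ τ)) τ := by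
  refine (hψ.differentiable θ hθ hcos τ hτ).hasDerivAt.congr_deriv ?_
  rw [eq_inv_mul_iff_mul_eq₀ hcos, source, photonDensity]
  linear_combination hψ.transport θ hθ hcos τ hτ

lemma laplace_transport (hψ : IsDiffuseFlux ω θ₀ ψ) (hθ₀ : 0 < Real.cos θ₀) (hs : 0 < s.re)
    (hθ : θ ∈ Ioo (-Real.pi) Real.pi) (hcos : Real.cos θ ≠ 0) :
    (1 + s * (Real.cos θ : ℂ)) * laplace (ψ θ) s = (Real.cos θ : ℂ) * (ψ θ 0 : ℂ) +
      ω / (2 * Real.pi) * laplace (source ψ (Real.cos θ₀)) s := by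
  have hint_ψ := integrableOn_laplaceIntegrand (hψ.laplace_angle θ hθ hcos s.re hs) le_rfl
  have hint_source := integrableOn_laplaceIntegrand (hψ.integrableOn_source hθ₀ hs) le_rfl
  have hcos' : (Real.cos θ : ℂ) ≠ 0 := ofReal_ne_zero.2 hcos
  have hsplit (τ : ℝ) : exp (-s * (τ : ℂ)) * (((Real.cos θ)⁻¹ *
      (ω / (2 * Real.pi) * source ψ (Real.cos θ₀) τ - ψ θ τ) : ℝ) : ℂ) =
      (Real.cos θ : ℂ)⁻¹ * (ω / (2 * Real.pi) *
        (exp (-s * (τ : ℂ)) * (source ψ (Real.cos θ₀) τ : ℂ)) -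
          exp (-s * (τ : ℂ)) * (ψ θ τ : ℂ)) := by
    push_cast
    ring
  have hint_sub := (hint_source.const_mul ((ω : ℂ) / (2 * Real.pi))).sub hint_ψ
  have hlaplace := laplace_of_hasDerivAt (hψ.continuous_boundary θ hθ hcos)
    (fun τ hτ => hψ.hasDerivAt_flux hθ hcos hτ) hint_ψ
    ((hint_sub.const_mul (Real.cos θ : ℂ)⁻¹).congr (ae_of_all _ fun τ => (hsplit τ).symm))
  have hsource : laplace (fun τ => (Real.cos θ)⁻¹ *
      (ω / (2 * Real.pi) * source ψ (Real.cos θ₀) τ - ψ θ τ)) s = (Real.cos θ : ℂ)⁻¹ *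
        (ω / (2 * Real.pi) * laplace (source ψ (Real.cos θ₀)) s - laplace (ψ θ) s) := by
    simp only [laplace, hsplit]
    rw [integral_const_mul, integral_sub (hint_source.const_mul _) hint_ψ, integral_const_mul]
  rw [hsource, inv_mul_eq_iff_eq_mul₀ hcos'] at hlaplace
  linear_combination -hlaplace

lemma ae_cos_mem_Icc_of_boundary_ne_zero (hψ : IsDiffuseFlux ω θ₀ ψ) :
    ∀ᵐ θ ∂volume.restrict (Ioo (-Real.pi) Real.pi),
      (Real.cos θ : ℂ) * (ψ θ 0 : ℂ) ≠ 0 → Real.cos θ ∈ Icc (-1) 0 := by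
  filter_upwards [ae_restrict_mem measurableSet_Ioo] with θ hθ hne
  refine ⟨Real.neg_one_le_cos θ, cos_nonpos_of_pi_div_two_le_abs ?_ (abs_lt.2 hθ)⟩
  by_contra! hlt
  exact hne (by rw [hψ.no_reentrant θ hlt, ofReal_zero, mul_zero])

lemma ae_laplace_transport (hψ : IsDiffuseFlux ω θ₀ ψ) (hθ₀ : 0 < Real.cos θ₀) (hs : 0 < s.re) :
    ∀ᵐ θ ∂volume.restrict (Ioo (-Real.pi) Real.pi),
      (1 + s * (Real.cos θ : ℂ)) * laplace (ψ θ) s = (Real.cos θ : ℂ) * (ψ θ 0 : ℂ) +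
        ω / (2 * Real.pi) * laplace (source ψ (Real.cos θ₀)) s := by
  filter_upwards [ae_restrict_mem measurableSet_Ioo, ae_restrict_of_ae ae_cos_ne_zero]
    with θ hθ hcos using hψ.laplace_transport hθ₀ hs hθ hcos

-- At `s = 1` the other terms of the transformed transport equation are integrable in the angle.
lemma integrableOn_boundary (hψ : IsDiffuseFlux ω θ₀ ψ) (hθ₀ : 0 < Real.cos θ₀) :
    IntegrableOn (fun θ => (Real.cos θ : ℂ) * (ψ θ 0 : ℂ)) (Ioo (-Real.pi) Real.pi) := by
  have hone : (0 : ℝ) < (1 : ℂ).re := by simp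
  have hbdd (θ : ℝ) : ‖1 + 1 * (Real.cos θ : ℂ)‖ ≤ 2 := by
    refine (norm_add_le _ _).trans ?_
    rw [one_mul, norm_one, norm_real, Real.norm_eq_abs]
    linarith [Real.abs_cos_le_one θ]
  have hlaplace := (hψ.integrableOn_laplace_angle hone).bdd_mul
    (by fun_prop : Continuous fun θ : ℝ => 1 + 1 * (Real.cos θ : ℂ)).aestronglyMeasurable
    (ae_of_all _ hbdd)
  refine (hlaplace.sub
    (integrable_const (ω / (2 * Real.pi) * laplace (source ψ (Real.cos θ₀)) 1))).congr ?_
  filter_upwards [hψ.ae_laplace_transport hθ₀ hone] with θ hθ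
  rw [Pi.sub_apply, hθ, add_sub_cancel_right]

lemma norm_boundaryTerm_le (hψ : IsDiffuseFlux ω θ₀ ψ) (hθ₀ : 0 < Real.cos θ₀) (hm : 0 ≤ m)
    (hm1 : m < 1) (hs : s.re ≤ m) : ‖boundaryTerm ψ s‖ ≤
      (∫ θ in Ioo (-Real.pi) Real.pi, ‖(Real.cos θ : ℂ) * (ψ θ 0 : ℂ)‖) / (1 - m) :=
  norm_integral_div_one_add_mul_le (hψ.integrableOn_boundary hθ₀)
    hψ.ae_cos_mem_Icc_of_boundary_ne_zero hm hm1 hs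

lemma differentiableAt_boundaryTerm (hψ : IsDiffuseFlux ω θ₀ ψ) (hθ₀ : 0 < Real.cos θ₀)
    (hs : s.re < 1) : DifferentiableAt ℂ (boundaryTerm ψ) s :=
  differentiableAt_integral_div_one_add_mul (hψ.integrableOn_boundary hθ₀) Real.measurable_cos
    hψ.ae_cos_mem_Icc_of_boundary_ne_zero hs

lemma laplace_photonDensity_eq_boundaryTerm_add (hψ : IsDiffuseFlux ω θ₀ ψ)
    (hθ₀ : 0 < Real.cos θ₀) (hs : 0 < s.re) (hs1 : s.re < 1) :
    laplace (photonDensity ψ) s = boundaryTerm ψ s +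
      ω / (2 * Real.pi) * laplace (source ψ (Real.cos θ₀)) s *
        ∫ θ in (-Real.pi)..Real.pi, 1 / (1 + s * (Real.cos θ : ℂ)) := by
  have hne (θ : ℝ) : 1 + s * (Real.cos θ : ℂ) ≠ 0 := ne_zero_of_re_pos (by
    rw [add_re, one_re, re_mul_ofReal]
    nlinarith [Real.neg_one_le_cos θ])
  have hcont : Continuous fun θ : ℝ => 1 / (1 + s * (Real.cos θ : ℂ)) :=
    continuous_const.div (by fun_prop) hne
  have hkernel : IntegrableOn (fun θ : ℝ => 1 / (1 + s * (Real.cos θ : ℂ)))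
      (Ioo (-Real.pi) Real.pi) := hcont.integrableOn_Icc.mono_set Ioo_subset_Icc_self
  have hboundary := integrable_div_one_add_mul (hψ.integrableOn_boundary hθ₀)
    Real.measurable_cos hψ.ae_cos_mem_Icc_of_boundary_ne_zero hs1
  rw [hψ.laplace_photonDensity hs, boundaryTerm,
    intervalIntegral.integral_of_le (by linarith [Real.pi_pos]), integral_Ioc_eq_integral_Ioo,
    ← integral_const_mul, ← integral_add hboundary (hkernel.const_mul _)]
  refine integral_congr_ae ?_
  filter_upwards [hψ.ae_laplace_transport hθ₀ hs] with θ hθ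
  rw [mul_one_div, ← add_div, eq_div_iff (hne θ), mul_comm, hθ]

lemma wienerHopf_equation (hψ : IsDiffuseFlux ω θ₀ ψ) (hθ₀ : 0 < Real.cos θ₀) (hs : 0 < s.re)
    (hs1 : s.re < 1) :
    laplace (source ψ (Real.cos θ₀)) s * (1 - (ω : ℂ) / stripSqrt s) =
      (Real.cos θ₀ : ℂ) / (1 + (Real.cos θ₀ : ℂ) * s) + boundaryTerm ψ s := by
  have hs_abs : |s.re| < 1 := by rwa [abs_of_pos hs]
  have hdensity := hψ.laplace_photonDensity_eq_boundaryTerm_add hθ₀ hs hs1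
  have hangular : (ω : ℂ) / (2 * Real.pi) * laplace (source ψ (Real.cos θ₀)) s *
      (2 * Real.pi * I / (I * stripSqrt s)) =
        laplace (source ψ (Real.cos θ₀)) s * ((ω : ℂ) / stripSqrt s) := by
    have hpi : (Real.pi : ℂ) ≠ 0 := ofReal_ne_zero.2 Real.pi_ne_zero
    have hw := stripSqrt_ne_zero hs_abs
    field_simp
  rw [integral_angular hs_abs, branchSqrt_eq, hangular] at hdensity
  linear_combination hψ.laplace_source hθ₀ hs + hdensity

lemma boundary_eq_laplace_source (hψ : IsDiffuseFlux ω θ₀ ψ) (hθ₀ : 0 < Real.cos θ₀)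
    (hθ : θ ∈ Ioo (-Real.pi) Real.pi) (hcos : Real.cos θ < 0) :
    (ψ θ 0 : ℂ) = -((ω : ℂ) / (2 * Real.pi * Real.cos θ)) *
      laplace (source ψ (Real.cos θ₀)) (-1 / (Real.cos θ : ℂ)) := by
  have hcos' : (Real.cos θ : ℂ) ≠ 0 := ofReal_ne_zero.2 hcos.ne
  have hpi : (Real.pi : ℂ) ≠ 0 := ofReal_ne_zero.2 Real.pi_ne_zero
  have htransport := hψ.laplace_transport hθ₀ (neg_inv_ofReal_re_pos hcos) hθ hcos.ne
  rw [div_mul_cancel₀ _ hcos', add_neg_cancel, zero_mul] at htransport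
  field_simp at htransport ⊢
  linear_combination -htransport

end IsDiffuseFlux

end Transport

section Matching

lemma norm_one_add_ofReal_mul_le {x : ℝ} (hx : |x| ≤ 1) (s : ℂ) :
    ‖1 + (x : ℂ) * s‖ ≤ 1 + ‖s‖ := by
  refine (norm_add_le _ _).trans ?_
  rw [norm_one, norm_mul, norm_real, Real.norm_eq_abs]
  gcongr
  exact mul_le_of_le_one_left (norm_nonneg _) hx

lemma norm_add_ofReal_div_add_one_le {p : ℝ} {s : ℂ} (hp : 0 ≤ p) (hp1 : p ≤ 1)
    (hs : 0 ≤ s.re) : ‖(s + p) / (s + 1)‖ ≤ 1 := by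
  rw [norm_div]
  refine div_le_one_of_le₀ ((sq_le_sq₀ (norm_nonneg _) (norm_nonneg _)).1 ?_) (norm_nonneg _)
  rw [← normSq_eq_norm_sq, ← normSq_eq_norm_sq, normSq_apply, normSq_apply]
  simp only [add_re, add_im, ofReal_re, ofReal_im, one_re, one_im]
  nlinarith

lemma norm_sub_one_div_sub_ofReal_le {p m : ℝ} {s : ℂ} (hp1 : p ≤ 1) (hm : m < p)
    (hs : s.re ≤ m) : ‖(s - 1) / (s - p)‖ ≤ 1 + (1 - p) / (p - m) := by
  have hlower : p - m ≤ ‖s - p‖ := by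
    rw [norm_sub_rev]
    refine le_trans ?_ (re_le_norm _)
    rw [sub_re, ofReal_re]
    linarith
  have hpm : 0 < p - m := sub_pos.2 hm
  have hne : s - p ≠ 0 := norm_pos_iff.1 (hpm.trans_le hlower)
  have hsplit : (s - 1) / (s - p) = 1 - ((1 - p : ℝ) : ℂ) / (s - p) := by
    field_simp
    push_cast
    ring
  rw [hsplit]
  refine (norm_sub_le _ _).trans ?_
  rw [norm_one, norm_div, norm_real, Real.norm_of_nonneg (sub_nonneg.2 hp1)]
  have := sub_nonneg.2 hp1
  gcongr

/-- The function `Ŝ(s) (s + s₊)(1 + μ₀ s) / ((s + 1) κ₋(s))`, with `Ŝ` the Laplace transform of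
`source ψ μ₀`: the side of the factored Wiener-Hopf equation that is analytic in `Re s > 0`. -/
noncomputable def rightSide (ω μ₀ β : ℝ) (ψ : ℝ → ℝ → ℝ) (s : ℂ) : ℂ :=
  laplace (source ψ μ₀) s * ((s + sPlus ω) / (s + 1) * (1 + μ₀ * s) * (kappaMinus ω β s)⁻¹)

/-- The side of the factored Wiener-Hopf equation that is analytic in `Re s < β`; unlike
`rightSide` it involves only the flux through the boundary. -/
noncomputable def leftSide (ω μ₀ β : ℝ) (ψ : ℝ → ℝ → ℝ) (s : ℂ) : ℂ :=
  (μ₀ + (1 + μ₀ * s) * boundaryTerm ψ s) * ((s - 1) / (s - sPlus ω)) * (kappaPlus ω β s)⁻¹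

lemma sub_ofReal_ne_zero_of_re_lt {p : ℝ} {s : ℂ} (hs : s.re < p) : s - (p : ℂ) ≠ 0 :=
  sub_ne_zero.2 fun h => hs.ne (by rw [h, ofReal_re])

lemma add_ofReal_ne_zero_of_re_pos {p : ℝ} {s : ℂ} (hp : 0 ≤ p) (hs : 0 < s.re) :
    s + (p : ℂ) ≠ 0 :=
  ne_zero_of_re_pos (by rw [add_re, ofReal_re]; linarith)

lemma one_add_ofReal_mul_ne_zero {μ : ℝ} {s : ℂ} (hμ : 0 ≤ μ) (hs : 0 ≤ s.re) :
    1 + (μ : ℂ) * s ≠ 0 :=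
  ne_zero_of_re_pos (by rw [add_re, one_re, re_ofReal_mul]; nlinarith)

lemma kappaPlus_ne_zero (ω β : ℝ) (s : ℂ) : kappaPlus ω β s ≠ 0 := cauchyExp_ne_zero ω β s

lemma kappaMinus_ne_zero (ω β : ℝ) (s : ℂ) : kappaMinus ω β s ≠ 0 := cauchyExp_ne_zero ω (-β) s

lemma differentiableAt_kappaPlus {ω β : ℝ} {s : ℂ} (hβ₀ : 0 < β) (hβ₁ : β < sPlus ω)
    (hs : s.re < β) : DifferentiableAt ℂ (kappaPlus ω β) s :=
  differentiableAt_cauchyExp (by rwa [abs_of_pos hβ₀]) hs.ne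

lemma differentiableAt_kappaMinus {ω β : ℝ} {s : ℂ} (hβ₀ : 0 < β) (hβ₁ : β < sPlus ω)
    (hs : -β < s.re) : DifferentiableAt ℂ (kappaMinus ω β) s :=
  differentiableAt_cauchyExp (by rwa [abs_neg, abs_of_pos hβ₀]) hs.ne'

lemma exists_norm_rightSide_factor_le {ω μ β : ℝ} (hμ : |μ| ≤ 1) (hβ₀ : 0 < β)
    (hβ₁ : β < sPlus ω) :
    ∃ C, ∀ s : ℂ, 0 ≤ s.re →
      ‖(s + sPlus ω) / (s + 1) * (1 + μ * s) * (kappaMinus ω β s)⁻¹‖ ≤ C * (1 + ‖s‖) := by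
  obtain ⟨C, hC⟩ := exists_norm_inv_cauchyExp_le (c := -β) (by rwa [abs_neg, abs_of_pos hβ₀]) hβ₀
  refine ⟨C, fun s hs => ?_⟩
  have hκ : ‖(kappaMinus ω β s)⁻¹‖ ≤ C :=
    hC s (by rw [abs_of_neg (by linarith)]; linarith)
  have hfrac := norm_add_ofReal_div_add_one_le (sPlus_nonneg ω) (sPlus_le_one ω) hs
  have hlinear := norm_one_add_ofReal_mul_le hμ s
  rw [norm_mul, norm_mul]
  calc _ ≤ 1 * (1 + ‖s‖) * C := by gcongr
    _ = C * (1 + ‖s‖) := by ring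

namespace IsDiffuseFlux

variable {ω θ₀ β m θ : ℝ} {ψ : ℝ → ℝ → ℝ} {s : ℂ}

lemma rightSide_eq_leftSide (hψ : IsDiffuseFlux ω θ₀ ψ) (hθ₀ : 0 < Real.cos θ₀)
    (hβ₁ : β < sPlus ω) (hs : 0 < s.re) (hsβ : s.re < β) :
    rightSide ω (Real.cos θ₀) β ψ s = leftSide ω (Real.cos θ₀) β ψ s := by
  have hs_abs : |s.re| < β := by rwa [abs_of_pos hs]
  have hs_sPlus : s.re < sPlus ω := hsβ.trans hβ₁
  have hs1 : s.re < 1 := hs_sPlus.trans_le (sPlus_le_one ω)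
  have hκp := kappaPlus_ne_zero ω β s
  have hκm := kappaMinus_ne_zero ω β s
  have hsub_sPlus := sub_ofReal_ne_zero_of_re_lt hs_sPlus
  have hadd_one : s + 1 ≠ 0 := by simpa using add_ofReal_ne_zero_of_re_pos zero_le_one hs
  have hsub_one : s - 1 ≠ 0 := by simpa using sub_ofReal_ne_zero_of_re_lt hs1
  have hlinear := one_add_ofReal_mul_ne_zero hθ₀.le hs.le
  have hwh := hψ.wienerHopf_equation hθ₀ hs hs1
  rw [one_sub_div_stripSqrt (hs_abs.trans hβ₁), ← kappa_eq (hs_abs.trans hβ₁),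
    kappa_eq_div hβ₁ hs_abs, sq_sub_sq, ← one_pow (M := ℂ) 2, sq_sub_sq, one_pow] at hwh
  have hboundary : (Real.cos θ₀ : ℂ) + (1 + Real.cos θ₀ * s) * boundaryTerm ψ s =
      (1 + Real.cos θ₀ * s) * ((Real.cos θ₀ : ℂ) / (1 + Real.cos θ₀ * s) +
        boundaryTerm ψ s) := by
    rw [mul_add, mul_div_cancel₀ _ hlinear]
  rw [rightSide, leftSide, hboundary, ← hwh]
  field_simp

lemma differentiableAt_rightSide (hψ : IsDiffuseFlux ω θ₀ ψ) (hθ₀ : 0 < Real.cos θ₀)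
    (hβ₀ : 0 < β) (hβ₁ : β < sPlus ω) (hs : 0 < s.re) :
    DifferentiableAt ℂ (rightSide ω (Real.cos θ₀) β ψ) s := by
  have hκ := differentiableAt_kappaMinus hβ₀ hβ₁ (s := s) (by linarith)
  have hsource : DifferentiableAt ℂ (laplace (source ψ (Real.cos θ₀))) s :=
    differentiableAt_laplace (hψ.integrableOn_source hθ₀ (half_pos hs)) (half_lt_self hs)
  have hadd_one : s + 1 ≠ 0 := by simpa using add_ofReal_ne_zero_of_re_pos zero_le_one hs
  exact hsource.mul (DifferentiableAt.mul (DifferentiableAt.mul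
    (DifferentiableAt.fun_div (by fun_prop) (by fun_prop) hadd_one) (by fun_prop))
    (hκ.inv (kappaMinus_ne_zero ω β s)))

lemma differentiableAt_leftSide (hψ : IsDiffuseFlux ω θ₀ ψ) (hθ₀ : 0 < Real.cos θ₀)
    (hβ₀ : 0 < β) (hβ₁ : β < sPlus ω) (hs : s.re < β) :
    DifferentiableAt ℂ (leftSide ω (Real.cos θ₀) β ψ) s := by
  have hκ := differentiableAt_kappaPlus hβ₀ hβ₁ hs
  have hs_sPlus : s.re < sPlus ω := hs.trans hβ₁
  have hboundary := hψ.differentiableAt_boundaryTerm hθ₀ (hs_sPlus.trans_le (sPlus_le_one ω))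
  exact ((DifferentiableAt.const_add _ (DifferentiableAt.mul (by fun_prop) hboundary)).mul
    (DifferentiableAt.fun_div (by fun_prop) (by fun_prop)
      (sub_ofReal_ne_zero_of_re_lt hs_sPlus))).mul (hκ.inv (kappaPlus_ne_zero ω β s))

lemma exists_norm_rightSide_le (hψ : IsDiffuseFlux ω θ₀ ψ) (hθ₀ : 0 < Real.cos θ₀)
    (hβ₀ : 0 < β) (hβ₁ : β < sPlus ω) (hm : 0 < m) :
    ∃ C, ∀ s : ℂ, m ≤ s.re → ‖rightSide ω (Real.cos θ₀) β ψ s‖ ≤ C * (1 + ‖s‖) := by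
  obtain ⟨C, hC⟩ := exists_norm_rightSide_factor_le (Real.abs_cos_le_one θ₀) hβ₀ hβ₁
  set A := ∫ τ in Ioi (0 : ℝ), ‖Real.exp (-m * τ) * source ψ (Real.cos θ₀) τ‖
  refine ⟨A * C, fun s hs => ?_⟩
  rw [rightSide, norm_mul, mul_assoc A]
  exact mul_le_mul (norm_laplace_le (hψ.integrableOn_source hθ₀ hm) hs) (hC s (hm.le.trans hs))
    (norm_nonneg _) (integral_nonneg fun _ => norm_nonneg _)

lemma tendsto_inv_smul_rightSide (hψ : IsDiffuseFlux ω θ₀ ψ) (hθ₀ : 0 < Real.cos θ₀)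
    (hβ₀ : 0 < β) (hβ₁ : β < sPlus ω) :
    Tendsto (fun x : ℝ => (x : ℂ)⁻¹ • rightSide ω (Real.cos θ₀) β ψ x) atTop (𝓝 0) := by
  obtain ⟨C, hC⟩ := exists_norm_rightSide_factor_le (Real.abs_cos_le_one θ₀) hβ₀ hβ₁
  have hC0 : 0 ≤ C := by simpa using (norm_nonneg _).trans (hC 0 le_rfl)
  have hbdd : IsBoundedUnder (· ≤ ·) atTop (norm ∘ fun x : ℝ => (x : ℂ)⁻¹ *
      ((x + sPlus ω) / (x + 1) * (1 + Real.cos θ₀ * x) * (kappaMinus ω β x)⁻¹)) := by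
    refine isBoundedUnder_of_eventually_le (a := 2 * C) ?_
    filter_upwards [eventually_ge_atTop 1] with x hx
    have hx0 : 0 < x := one_pos.trans_le hx
    rw [Function.comp_apply, norm_mul, norm_inv, norm_real, Real.norm_of_nonneg hx0.le,
      inv_mul_le_iff₀ hx0]
    refine (hC x (by simpa using hx0.le)).trans ?_
    rw [norm_real, Real.norm_of_nonneg hx0.le]
    nlinarith
  refine ((tendsto_laplace_atTop (hψ.integrableOn_source hθ₀ one_pos)).zero_mul_isBoundedUnder_le
    hbdd).congr fun x => ?_
  rw [rightSide, smul_eq_mul]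
  ring

lemma exists_norm_leftSide_le (hψ : IsDiffuseFlux ω θ₀ ψ) (hθ₀ : 0 < Real.cos θ₀)
    (hβ₁ : β < sPlus ω) (hm : 0 ≤ m) (hmβ : m < β) :
    ∃ C, ∀ s : ℂ, s.re ≤ m → ‖leftSide ω (Real.cos θ₀) β ψ s‖ ≤ C * (1 + ‖s‖) := by
  have hm_sPlus : m < sPlus ω := hmβ.trans hβ₁
  obtain ⟨C, hC⟩ := exists_norm_inv_cauchyExp_le (c := β)
    (by rwa [abs_of_pos (hm.trans_lt hmβ)]) (sub_pos.2 hmβ)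
  set B := (∫ θ in Ioo (-Real.pi) Real.pi, ‖(Real.cos θ : ℂ) * (ψ θ 0 : ℂ)‖) / (1 - m)
  have hB (s : ℂ) (hs : s.re ≤ m) : ‖boundaryTerm ψ s‖ ≤ B :=
    hψ.norm_boundaryTerm_le hθ₀ hm (hm_sPlus.trans_le (sPlus_le_one ω)) hs
  set D := 1 + (1 - sPlus ω) / (sPlus ω - m)
  refine ⟨(1 + B) * D * C, fun s hs => ?_⟩
  have hB0 : 0 ≤ B := (norm_nonneg _).trans (hB s hs)
  have hκ : ‖(kappaPlus ω β s)⁻¹‖ ≤ C :=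
    hC s (by rw [abs_of_pos (by linarith)]; linarith)
  have hfrac : ‖(s - 1) / (s - sPlus ω)‖ ≤ D :=
    norm_sub_one_div_sub_ofReal_le (sPlus_le_one ω) hm_sPlus hs
  have hboundary : ‖(Real.cos θ₀ : ℂ) + (1 + Real.cos θ₀ * s) * boundaryTerm ψ s‖ ≤
      (1 + B) * (1 + ‖s‖) :=
    calc _ ≤ 1 + (1 + ‖s‖) * B := by
          refine norm_add_le_of_le ?_ (norm_mul_le_of_le
            (norm_one_add_ofReal_mul_le (Real.abs_cos_le_one θ₀) s) (hB s hs))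
          rw [norm_real]
          exact Real.abs_cos_le_one θ₀
      _ ≤ (1 + B) * (1 + ‖s‖) := by nlinarith [norm_nonneg s]
  rw [leftSide, norm_mul, norm_mul]
  have hD0 : 0 ≤ D := (norm_nonneg _).trans hfrac
  calc _ ≤ (1 + B) * (1 + ‖s‖) * D * C := by gcongr
    _ = (1 + B) * D * C * (1 + ‖s‖) := by ring

lemma rightSide_eq_leftSide_of_re (hψ : IsDiffuseFlux ω θ₀ ψ) (hθ₀ : 0 < Real.cos θ₀)
    (hβ₀ : 0 < β) (hβ₁ : β < sPlus ω) {t : ℂ} (hs : 0 < s.re) (ht : t.re < β) :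
    rightSide ω (Real.cos θ₀) β ψ s = leftSide ω (Real.cos θ₀) β ψ t := by
  obtain ⟨C₁, hC₁⟩ := hψ.exists_norm_rightSide_le hθ₀ hβ₀ hβ₁ (half_pos hβ₀)
  obtain ⟨C₂, hC₂⟩ := hψ.exists_norm_leftSide_le hθ₀ hβ₁ (half_pos hβ₀).le (half_lt_self hβ₀)
  exact eq_of_eqOn_strip_of_norm_le_linear (half_pos hβ₀) (half_lt_self hβ₀)
    (fun z hz => (hψ.differentiableAt_rightSide hθ₀ hβ₀ hβ₁ hz).differentiableWithinAt)
    (fun z hz => (hψ.differentiableAt_leftSide hθ₀ hβ₀ hβ₁ hz).differentiableWithinAt)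
    (fun z hz hzβ => hψ.rightSide_eq_leftSide hθ₀ hβ₁ hz hzβ) hC₁ hC₂
    (hψ.tendsto_inv_smul_rightSide hθ₀ hβ₀ hβ₁) hs ht

lemma leftSide_neg_inv_cos (hθ₀ : Real.cos θ₀ ≠ 0) : leftSide ω (Real.cos θ₀) β ψ
    (-1 / (Real.cos θ₀ : ℂ)) = (Real.cos θ₀ : ℂ) * (1 + Real.cos θ₀) /
      (kappaPlus ω β (-1 / (Real.cos θ₀ : ℂ)) * (1 + Real.cos θ₀ * sPlus ω)) := by
  have hcos : (Real.cos θ₀ : ℂ) ≠ 0 := ofReal_ne_zero.2 hθ₀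
  have hfrac : (-1 / (Real.cos θ₀ : ℂ) - 1) / (-1 / (Real.cos θ₀ : ℂ) - sPlus ω) =
      (1 + Real.cos θ₀) / (1 + Real.cos θ₀ * sPlus ω) := by
    rw [div_sub' hcos, div_sub' hcos, div_div_div_cancel_right₀ hcos, ← neg_div_neg_eq]
    congr 1 <;> ring
  rw [leftSide, mul_div_cancel₀ _ hcos, add_neg_cancel, zero_mul, add_zero, hfrac,
    ← mul_div_assoc, ← div_eq_mul_inv, div_div, mul_comm (kappaPlus _ _ _)]

lemma laplace_source_eq (hψ : IsDiffuseFlux ω θ₀ ψ) (hθ₀ : 0 < Real.cos θ₀)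
    (hβ₀ : 0 < β) (hβ₁ : β < sPlus ω) (hs : 0 < s.re) :
    laplace (source ψ (Real.cos θ₀)) s = (Real.cos θ₀ : ℂ) * (1 + Real.cos θ₀) /
        (kappaPlus ω β (-1 / (Real.cos θ₀ : ℂ)) * (1 + Real.cos θ₀ * sPlus ω)) *
          ((s + 1) * kappaMinus ω β s / ((s + sPlus ω) * (1 + Real.cos θ₀ * s))) := by
  have hre : (-1 / (Real.cos θ₀ : ℂ)).re < β := by
    rw [div_ofReal_re, neg_re, one_re]
    exact (div_neg_of_neg_of_pos neg_one_lt_zero hθ₀).trans hβ₀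
  have hκm := kappaMinus_ne_zero ω β s
  have hadd_one : s + 1 ≠ 0 := by simpa using add_ofReal_ne_zero_of_re_pos zero_le_one hs
  have hadd_sPlus := add_ofReal_ne_zero_of_re_pos (sPlus_nonneg ω) hs
  have hlinear := one_add_ofReal_mul_ne_zero hθ₀.le hs.le
  rw [← leftSide_neg_inv_cos hθ₀.ne', ← hψ.rightSide_eq_leftSide_of_re hθ₀ hβ₀ hβ₁ hs hre,
    rightSide]
  field_simp
  rw [mul_div_cancel_right₀ _ (by rwa [mul_comm s])]

end IsDiffuseFlux

end Matching

section EmergentFlux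

lemma kappaMinus_inv_ofReal (ω β μ : ℝ) :
    kappaMinus ω β (1 / (μ : ℂ)) = (kappaPlus ω β (-1 / (μ : ℂ)))⁻¹ := by
  rw [kappaMinus_eq, neg_div]

lemma kappaMinus_neg_inv_ofReal (ω β μ : ℝ) :
    kappaMinus ω β (-1 / (μ : ℂ)) = (kappaPlus ω β (1 / (μ : ℂ)))⁻¹ := by
  rw [kappaMinus_eq, neg_div, neg_neg]

lemma neg_inv_add_eq {μ : ℂ} (hμ : μ ≠ 0) (p : ℂ) : -1 / μ + p = -((1 - μ * p) / μ) := by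
  rw [div_add' _ _ _ hμ, ← neg_div]
  ring

lemma one_add_mul_neg_inv_eq {μ : ℂ} (hμ : μ ≠ 0) (ν : ℂ) :
    1 + ν * (-1 / μ) = -((ν - μ) / μ) := by
  field_simp
  ring

namespace IsDiffuseFlux

variable {ω θ₀ β θ : ℝ} {ψ : ℝ → ℝ → ℝ}

lemma boundary_eq_laplace_photonDensity (hψ : IsDiffuseFlux ω θ₀ ψ) (hθ₀ : 0 < Real.cos θ₀)
    (hθ : θ ∈ Ioo (-Real.pi) Real.pi) (hcos : Real.cos θ < 0) :
    (ψ θ 0 : ℂ) =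
      -((ω : ℂ) / (2 * Real.pi * Real.cos θ)) *
          laplace (photonDensity ψ) (-1 / (Real.cos θ : ℂ)) +
        (ω : ℂ) / (2 * Real.pi) * ((Real.cos θ₀ : ℂ) / (Real.cos θ₀ - Real.cos θ)) := by
  have hμ : (Real.cos θ : ℂ) ≠ 0 := ofReal_ne_zero.2 hcos.ne
  have hsub : (Real.cos θ₀ : ℂ) - Real.cos θ ≠ 0 :=
    sub_ne_zero.2 (ofReal_injective.ne (hcos.trans hθ₀).ne')
  have hpi : (Real.pi : ℂ) ≠ 0 := ofReal_ne_zero.2 Real.pi_ne_zero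
  rw [hψ.boundary_eq_laplace_source hθ₀ hθ hcos,
    hψ.laplace_source hθ₀ (neg_inv_ofReal_re_pos hcos), one_add_mul_neg_inv_eq hμ]
  field_simp
  ring

lemma boundary_eq_kappaMinus_div_kappaPlus (hψ : IsDiffuseFlux ω θ₀ ψ)
    (hθ₀ : 0 < Real.cos θ₀) (hβ₀ : 0 < β) (hβ₁ : β < sPlus ω)
    (hθ : θ ∈ Ioo (-Real.pi) Real.pi) (hcos : Real.cos θ < 0) :
    (ψ θ 0 : ℂ) = (ω : ℂ) / (2 * Real.pi) *
      ((Real.cos θ₀ : ℂ) * (1 + Real.cos θ₀) * (1 - Real.cos θ) *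
          kappaMinus ω β (-1 / (Real.cos θ : ℂ)) /
        ((Real.cos θ₀ - Real.cos θ) * (1 + Real.cos θ₀ * sPlus ω) *
          (1 - Real.cos θ * sPlus ω) * kappaPlus ω β (-1 / (Real.cos θ₀ : ℂ)))) := by
  have hμ : (Real.cos θ : ℂ) ≠ 0 := ofReal_ne_zero.2 hcos.ne
  have hadd_one := neg_inv_add_eq hμ 1
  rw [mul_one] at hadd_one
  rw [hψ.boundary_eq_laplace_source hθ₀ hθ hcos,
    hψ.laplace_source_eq hθ₀ hβ₀ hβ₁ (neg_inv_ofReal_re_pos hcos), hadd_one,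
    neg_inv_add_eq hμ, one_add_mul_neg_inv_eq hμ]
  field_simp

lemma boundary_eq_kappaMinus_mul_kappaMinus (hψ : IsDiffuseFlux ω θ₀ ψ)
    (hθ₀ : 0 < Real.cos θ₀) (hβ₀ : 0 < β) (hβ₁ : β < sPlus ω)
    (hθ : θ ∈ Ioo (-Real.pi) Real.pi) (hcos : Real.cos θ < 0) :
    (ψ θ 0 : ℂ) = (ω : ℂ) / (2 * Real.pi) *
      ((Real.cos θ₀ : ℂ) * (1 + Real.cos θ₀) * (1 - Real.cos θ) /
        ((Real.cos θ₀ - Real.cos θ) * (1 + Real.cos θ₀ * sPlus ω) *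
          (1 - Real.cos θ * sPlus ω))) *
      (kappaMinus ω β (1 / (Real.cos θ₀ : ℂ)) * kappaMinus ω β (-1 / (Real.cos θ : ℂ))) := by
  rw [hψ.boundary_eq_kappaMinus_div_kappaPlus hθ₀ hβ₀ hβ₁ hθ hcos, kappaMinus_inv_ofReal]
  field_simp

lemma boundary_eq_inv_kappaPlus_mul_kappaPlus (hψ : IsDiffuseFlux ω θ₀ ψ)
    (hθ₀ : 0 < Real.cos θ₀) (hβ₀ : 0 < β) (hβ₁ : β < sPlus ω)
    (hθ : θ ∈ Ioo (-Real.pi) Real.pi) (hcos : Real.cos θ < 0) :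
    (ψ θ 0 : ℂ) = (ω : ℂ) / (2 * Real.pi) *
      ((Real.cos θ₀ : ℂ) * (1 + Real.cos θ₀) * (1 - Real.cos θ) /
        ((Real.cos θ₀ - Real.cos θ) * (1 + Real.cos θ₀ * sPlus ω) *
          (1 - Real.cos θ * sPlus ω))) *
      (1 / (kappaPlus ω β (-1 / (Real.cos θ₀ : ℂ)) * kappaPlus ω β (1 / (Real.cos θ : ℂ)))) := by
  rw [hψ.boundary_eq_kappaMinus_mul_kappaMinus hθ₀ hβ₀ hβ₁ hθ hcos, kappaMinus_inv_ofReal,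
    kappaMinus_neg_inv_ofReal, one_div (kappaPlus _ _ _ * _), mul_inv]

end IsDiffuseFlux

end EmergentFlux

end Albedo

open Albedo in
theorem mainTheorem1_general (ω θ₀ μ₀ : ℝ) (hθ₀ : |θ₀| < Real.pi / 2) (hμ₀ : μ₀ = Real.cos θ₀)
    (β : ℝ) (hβ₀ : 0 < β) (hβ₁ : β < sPlus ω)
    (ψ : ℝ → ℝ → ℝ) (hψ : IsDiffuseFlux ω θ₀ ψ) :
    (∀ s : ℂ, |s.re| < 1 →
      (∫ θ in (-Real.pi)..Real.pi, 1 / (1 + s * (Real.cos θ : ℂ))) =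
        2 * (Real.pi : ℂ) * Complex.I / branchSqrt s) ∧
    (∀ s : ℂ, s.re < β → Integrable (contourIntegrand ω β s)) ∧
    (∀ s : ℂ, -β < s.re → Integrable (contourIntegrand ω (-β) s)) ∧
    DifferentiableOn ℂ (kappaPlus ω β) {s : ℂ | s.re < β} ∧
    DifferentiableOn ℂ (kappaMinus ω β) {s : ℂ | -β < s.re} ∧
    (∀ s : ℂ, |s.re| < β → kappa ω s = kappaPlus ω β s / kappaMinus ω β s) ∧
    (∀ s : ℂ, 0 < s.re →
      laplace (photonDensity ψ) s =
        (μ₀ : ℂ) * (1 + μ₀) / (kappaPlus ω β (-1 / (μ₀ : ℂ)) * (1 + μ₀ * sPlus ω)) *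
          ((s + 1) * kappaMinus ω β s / ((s + sPlus ω) * (1 + μ₀ * s)))
        - (μ₀ : ℂ) / (1 + μ₀ * s)) ∧
    (∀ θ μ : ℝ, Real.pi / 2 < |θ| → |θ| < Real.pi → μ = Real.cos θ →
      ((ψ θ 0 : ℝ) : ℂ) =
        -((ω : ℂ) / (2 * Real.pi * μ)) * laplace (photonDensity ψ) (-1 / (μ : ℂ))
          + (ω : ℂ) / (2 * Real.pi) * ((μ₀ : ℂ) / (μ₀ - μ)) ∧
      ((ψ θ 0 : ℝ) : ℂ) =
        (ω : ℂ) / (2 * Real.pi) *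
          ((μ₀ : ℂ) * (1 + μ₀) * (1 - μ) * kappaMinus ω β (-1 / (μ : ℂ)) /
            ((μ₀ - μ) * (1 + μ₀ * sPlus ω) * (1 - μ * sPlus ω) *
              kappaPlus ω β (-1 / (μ₀ : ℂ)))) ∧
      ((ψ θ 0 : ℝ) : ℂ) =
        (ω : ℂ) / (2 * Real.pi) *
          ((μ₀ : ℂ) * (1 + μ₀) * (1 - μ) /
            ((μ₀ - μ) * (1 + μ₀ * sPlus ω) * (1 - μ * sPlus ω))) *
          (kappaMinus ω β (1 / (μ₀ : ℂ)) * kappaMinus ω β (-1 / (μ : ℂ))) ∧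
      ((ψ θ 0 : ℝ) : ℂ) =
        (ω : ℂ) / (2 * Real.pi) *
          ((μ₀ : ℂ) * (1 + μ₀) * (1 - μ) /
            ((μ₀ - μ) * (1 + μ₀ * sPlus ω) * (1 - μ * sPlus ω))) *
          (1 / (kappaPlus ω β (-1 / (μ₀ : ℂ)) * kappaPlus ω β (1 / (μ : ℂ))))) := by
  have hcos₀ : 0 < Real.cos θ₀ := Real.cos_pos_of_mem_Ioo (abs_lt.1 hθ₀)
  have hβ : |β| < sPlus ω := by rwa [abs_of_pos hβ₀]
  have hβ' : |-β| < sPlus ω := by rwa [abs_neg]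
  subst hμ₀
  refine ⟨fun s hs => integral_angular hs, fun s hs => integrable_contourIntegrand hβ hs.ne,
    fun s hs => integrable_contourIntegrand hβ' hs.ne',
    fun s hs => (differentiableAt_kappaPlus hβ₀ hβ₁ hs).differentiableWithinAt,
    fun s hs => (differentiableAt_kappaMinus hβ₀ hβ₁ hs).differentiableWithinAt,
    fun s hs => kappa_eq_div hβ₁ hs, fun s hs => ?_, ?_⟩
  · rw [← hψ.laplace_source_eq hcos₀ hβ₀ hβ₁ hs, hψ.laplace_source hcos₀ hs, add_sub_cancel_right]
  · rintro θ μ hθ_gt hθ_lt rfl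
    have hθ : θ ∈ Ioo (-Real.pi) Real.pi := abs_lt.1 hθ_lt
    have hcos : Real.cos θ < 0 := by
      rw [← Real.cos_abs]
      exact Real.cos_neg_of_pi_div_two_lt_of_lt hθ_gt (by linarith [Real.pi_pos])
    exact ⟨hψ.boundary_eq_laplace_photonDensity hcos₀ hθ hcos,
      hψ.boundary_eq_kappaMinus_div_kappaPlus hcos₀ hβ₀ hβ₁ hθ hcos,
      hψ.boundary_eq_kappaMinus_mul_kappaMinus hcos₀ hβ₀ hβ₁ hθ hcos,
      hψ.boundary_eq_inv_kappaPlus_mul_kappaPlus hcos₀ hβ₀ hβ₁ hθ hcos⟩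

open Albedo in
theorem mainTheorem1 (ω : ℝ) (hω₀ : 0 ≤ ω) (hω₁ : ω < 1)
    (θ₀ μ₀ : ℝ) (hθ₀ : |θ₀| < Real.pi / 2) (hμ₀ : μ₀ = Real.cos θ₀)
    (β : ℝ) (hβ₀ : 0 < β) (hβ₁ : β < sPlus ω)
    (ψ : ℝ → ℝ → ℝ) (hψ : IsDiffuseFlux ω θ₀ ψ) :
    -- the angular integral behind `κ`
    (∀ s : ℂ, |s.re| < 1 →
      (∫ θ in (-Real.pi)..Real.pi, 1 / (1 + s * (Real.cos θ : ℂ))) =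
        2 * (Real.pi : ℂ) * Complex.I / branchSqrt s) ∧
    -- the factors `κ₊`, `κ₋` are well defined, analytic in overlapping half-planes, and split `κ`
    (∀ s : ℂ, s.re < β → Integrable (contourIntegrand ω β s)) ∧
    (∀ s : ℂ, -β < s.re → Integrable (contourIntegrand ω (-β) s)) ∧
    DifferentiableOn ℂ (kappaPlus ω β) {s : ℂ | s.re < β} ∧
    DifferentiableOn ℂ (kappaMinus ω β) {s : ℂ | -β < s.re} ∧
    (∀ s : ℂ, |s.re| < β → kappa ω s = kappaPlus ω β s / kappaMinus ω β s) ∧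
    -- the Laplace-transformed photon density
    (∀ s : ℂ, 0 < s.re →
      laplace (photonDensity ψ) s =
        (μ₀ : ℂ) * (1 + μ₀) / (kappaPlus ω β (-1 / (μ₀ : ℂ)) * (1 + μ₀ * sPlus ω)) *
          ((s + 1) * kappaMinus ω β s / ((s + sPlus ω) * (1 + μ₀ * s)))
        - (μ₀ : ℂ) / (1 + μ₀ * s)) ∧
    -- the emergent diffuse flux, in its equivalent forms
    (∀ θ μ : ℝ, Real.pi / 2 < |θ| → |θ| < Real.pi → μ = Real.cos θ →
      ((ψ θ 0 : ℝ) : ℂ) =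
        -((ω : ℂ) / (2 * Real.pi * μ)) * laplace (photonDensity ψ) (-1 / (μ : ℂ))
          + (ω : ℂ) / (2 * Real.pi) * ((μ₀ : ℂ) / (μ₀ - μ)) ∧
      ((ψ θ 0 : ℝ) : ℂ) =
        (ω : ℂ) / (2 * Real.pi) *
          ((μ₀ : ℂ) * (1 + μ₀) * (1 - μ) * kappaMinus ω β (-1 / (μ : ℂ)) /
            ((μ₀ - μ) * (1 + μ₀ * sPlus ω) * (1 - μ * sPlus ω) *
              kappaPlus ω β (-1 / (μ₀ : ℂ)))) ∧
      ((ψ θ 0 : ℝ) : ℂ) =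
        (ω : ℂ) / (2 * Real.pi) *
          ((μ₀ : ℂ) * (1 + μ₀) * (1 - μ) /
            ((μ₀ - μ) * (1 + μ₀ * sPlus ω) * (1 - μ * sPlus ω))) *
          (kappaMinus ω β (1 / (μ₀ : ℂ)) * kappaMinus ω β (-1 / (μ : ℂ))) ∧
      ((ψ θ 0 : ℝ) : ℂ) =
        (ω : ℂ) / (2 * Real.pi) *
          ((μ₀ : ℂ) * (1 + μ₀) * (1 - μ) /
            ((μ₀ - μ) * (1 + μ₀ * sPlus ω) * (1 - μ * sPlus ω))) *
          (1 / (kappaPlus ω β (-1 / (μ₀ : ℂ)) * kappaPlus ω β (1 / (μ : ℂ))))) :=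
  mainTheorem1_general ω θ₀ μ₀ hθ₀ hμ₀ β hβ₀ hβ₁ ψ hψ
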